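/- \textbf{Setting.} Let $\mathcal X,\mathcal Y,\mathcal W$ be measurable spaces, $\Theta\subset\mathbb R^p$, and let $\mathbb P_{g(x,\theta)}$ be the working conditional law of $Y$ given $X=x$ under the regression function $g(\cdot,\theta)$; it depends on $(x,\theta)$ only through $g(x,\theta)$ and is measurable in $x$. For a measure $\mathbb P_X$ on $\mathcal X$, $\mathbb P_X\mathbb P_{g(X,\theta)}$ is the joint law with $X$-marginal $\mathbb P_X$ and conditional law $\mathbb P_{g(x,\theta)}$. For a bounded measurable positive-definite kernel $k$ with reproducing kernel Hilbert space $\mathcal H_k$, put $\mathrm{MMD}_k(P,Q)=\|\mu_P-\mu_Q\|_{\mathcal H_k}$, where $\mu_P=\int k(\cdot,z)\,P(\mathrm dz)$; $k$ is characteristic if, for probability measures, $\mathrm{MMD}_k(P,Q)=0$ iff $P=Q$. For each $n\ge1$ let $c=c_n\ge 0$ and $m=m_n\ge1$. Let $\mathcal D=\{(W_i,Y_i)\}_{i\le n}$ be the observations and $S=\{\tilde X_{ij}\}_{i\le n,\,j\le m}$ the ($\mathcal X$-valued) pseudo-samples; arbitrary joint laws are allowed (in particular posterior predictive pseudo-samples,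 or $m=1$ and $\tilde X_{i1}=W_i$). Let $\mathbb Q_{XY,i},\mathbb Q_{X,i}$ be prior centring probability measures on $\mathcal X\times\mathcal Y$ and $\mathcal X$, which may depend measurably on $\mathcal D$. Put $$\mathbb P^{\rm base}_{XY,i}=\tfrac{c}{c+m}\mathbb Q_{XY,i}+\tfrac1{c+m}\sum_{j=1}^m\delta_{(\tilde X_{ij},Y_i)},\qquad \mathbb P^{\rm base}_{X,i}=\tfrac{c}{c+m}\mathbb Q_{X,i}+\tfrac1{c+m}\sum_{j=1}^m\delta_{\tilde X_{ij}},$$ and $\mathbb P^{\rm base}_{XY}=\frac1n\sum_i\mathbb P^{\rm base}_{XY,i}$, $\mathbb P^{\rm base}_{X}=\frac1n\sum_i\mathbb P^{\rm base}_{X,i}$. Conditionally on $(\mathcal D,S)$, let $\mathbb P^{\rm DP}_{X,Y|W_i}\sim \mathrm{DP}(c+m,\mathbb P^{\rm base}_{XY,i})$, $i\le n$, be independent draws from Dirichlet processes, and likewise $\mathbb P^{\rm DP}_{X|W_i}\sim \mathrm{DP}(c+m,\mathbb P^{\rm base}_{X,i})$, $i\le n$. With $k=k_X\otimes k_Y$,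 let $$M_n(\theta)=\mathrm{MMD}_k\Bigl(\tfrac1n\sum_{i=1}^n\mathbb P^{\rm DP}_{X,Y|W_i},\ \bigl(\tfrac1n\sum_{i=1}^n\mathbb P^{\rm DP}_{X|W_i}\bigr)\mathbb P_{g(X,\theta)}\Bigr),$$ and let $\hat\theta_n\in\Theta$ be, almost surely, a minimiser of $M_n$ over $\Theta$. \textbf{Theorem.} Assume: (G1) $k_X,k_Y$ are measurable, positive-definite and characteristic kernels on $\mathcal X,\mathcal Y$ with $\sup k_X<\infty$ and $\sup k_Y<\infty$; (G2) for each $\theta\in\Theta$ there is a bounded linear operator $\mathcal C_\theta:\mathcal H_{k_X}\to\mathcal H_{k_Y}$ with $\mathcal C_\theta k_X(x,\cdot)=\int k_Y(y,\cdot)\,\mathbb P_{g(x,\theta)}(\mathrm dy)$ for all $x\in\mathcal X$, and $\sup_{\theta\in\Theta}\|\mathcal C_\theta\|<\infty$. Suppose there are fixed probability measures $\mathbb P^\infty_{XY}$ on $\mathcal X\times\mathcal Y$ and $\mathbb P^\infty_X$ on $\mathcal X$ such that, as $n\to\infty$, $$\mathrm{MMD}_k(\mathbb P^{\rm base}_{XY},\mathbb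 P^\infty_{XY})\to0\quad\text{and}\quad \mathrm{MMD}_{k_X^2}(\mathbb P^{\rm base}_{X},\mathbb P^\infty_{X})\to0\quad\text{in probability},$$ where $\mathrm{MMD}_{k_X^2}(P,Q)$ is the MMD with kernel $k_X\otimes k_X$ between the images of $P$ and $Q$ under $x\mapsto(x,x)$. Define $M(\theta)=\mathrm{MMD}_k(\mathbb P^\infty_{XY},\mathbb P^\infty_X\mathbb P_{g(X,\theta)})$. If $\Theta$ is compact, $M$ is continuous on $\Theta$, and $M$ attains its minimum over $\Theta$ at a unique point $\theta^\dagger$, which is interior to $\Theta$, then $\hat\theta_n\to\theta^\dagger$ in probability. -/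

import Mathlib

open MeasureTheory ProbabilityTheory Filter Topology
open scoped ENNReal

noncomputable section

namespace MMDNPL

/-! ### Positive-definite kernels and their reproducing kernel Hilbert spaces -/

/-- A real positive-definite kernel on a set `Z`: a symmetric function `k : Z → Z → ℝ` with
`∑ i, ∑ j, a i * a j * k (z i) (z j) ≥ 0` for all finite families of points and real weights. -/
structure PDKernel (Z : Type*) where
  /-- the kernel function -/
  toFun : Z → Z → ℝ
  posSemidef : (Matrix.of toFun).PosSemidef

/-- The kernel as a matrix of (scalar) operators on `ℝ`, the format in which Mathlib's RKHS
construction takes it. -/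
def PDKernel.opMatrix {Z : Type*} (k : PDKernel Z) : Matrix Z Z (ℝ →L[ℝ] ℝ) :=
  Matrix.of fun x y => k.toFun x y • ContinuousLinearMap.id ℝ ℝ

theorem PDKernel.symm {Z : Type*} (k : PDKernel Z) (x y : Z) : k.toFun x y = k.toFun y x := by
  have h := k.posSemidef.isHermitian.apply y x
  simpa using h

instance PDKernel.fact_posSemidef {Z : Type*} (k : PDKernel Z) : Fact k.opMatrix.PosSemidef := by
  have key := (RKHS.posSemidef_tfae (K := k.opMatrix)).out 0 2
  refine ⟨key.mpr ⟨?_, ?_⟩⟩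
  · have hs : star (ContinuousLinearMap.id ℝ ℝ) = ContinuousLinearMap.id ℝ ℝ :=
      star_one (ℝ →L[ℝ] ℝ)
    ext x y
    simp [opMatrix, k.symm x y, hs]
  · intro v
    have h := k.posSemidef.2 v
    rw [Finsupp.sum_comm]
    refine le_of_le_of_eq h ?_
    simp only [opMatrix, Finsupp.sum, Matrix.of_apply, star_trivial, RCLike.re_to_real]
    refine Finset.sum_congr rfl fun i _ => Finset.sum_congr rfl fun j _ => ?_
    simp
    ring

/-- The reproducing kernel Hilbert space of `k`. -/
abbrev PDKernel.H {Z : Type*} (k : PDKernel Z) : Type _ := RKHS.OfKernel k.opMatrix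

/-- The canonical feature `k(z, ·) ∈ H`. -/
def PDKernel.feature {Z : Type*} (k : PDKernel Z) (z : Z) : k.H := RKHS.kerFun k.H z (1 : ℝ)

theorem PDKernel.feature_apply {Z : Type*} (k : PDKernel Z) (z x : Z) :
    k.feature z x = k.toFun z x := by
  unfold feature
  rw [RKHS.kerFun_apply, RKHS.OfKernel.kernel_ofKernel]
  simp [opMatrix, k.symm x z]

/-- The tensor product kernel `((x, y), (x', y')) ↦ kX(x, x') * kY(y, y')`. -/
def PDKernel.tensor {X Y : Type*} (kX : PDKernel X) (kY : PDKernel Y) : PDKernel (X × Y) where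
  toFun p q := kX.toFun p.1 q.1 * kY.toFun p.2 q.2
  posSemidef := (kX.posSemidef.submatrix Prod.fst).hadamard (kY.posSemidef.submatrix Prod.snd)

/-- Joint measurability of the kernel function. -/
def PDKernel.IsMeasurable {Z : Type*} [MeasurableSpace Z] (k : PDKernel Z) : Prop :=
  Measurable fun p : Z × Z => k.toFun p.1 p.2

/-- The supremum of the kernel is finite. -/
def PDKernel.IsBounded {Z : Type*} (k : PDKernel Z) : Prop :=
  BddAbove (Set.range fun p : Z × Z => k.toFun p.1 p.2)

/-! ### Mean embeddings and the maximum mean discrepancy -/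

open scoped Classical in
/-- The kernel mean embedding of `P`: the element of the RKHS which, as a function, is
`x ↦ ∫ k(x, z) dP(z)`. It is unique, and it exists for bounded measurable kernels and finite
measures; the value `0` is used otherwise. -/
def PDKernel.meanEmbedding {Z : Type*} [MeasurableSpace Z] (k : PDKernel Z) (P : Measure Z) : k.H :=
  if h : ∃ f : k.H, ∀ x, f x = ∫ z, k.toFun x z ∂P then h.choose else 0

theorem PDKernel.measurable_coe {Z : Type*} [MeasurableSpace Z] (k : PDKernel Z)
    (hk : k.IsMeasurable) (f : k.H) : Measurable f := by
  have hd := RKHS.kerFun_dense (𝕜 := ℝ) (H := k.H)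
  have hf : f ∈ (Submodule.span ℝ {u : k.H | ∃ x v, RKHS.kerFun k.H x v = u}).topologicalClosure :=
    hd ▸ Submodule.mem_top
  obtain ⟨u, hu, hlim⟩ := mem_closure_iff_seq_limit.mp hf
  refine measurable_of_tendsto_metrizable (f := fun n => (u n : Z → ℝ)) (fun n => ?_) ?_
  · refine Submodule.span_induction (p := fun (h : k.H) _ => Measurable (h : Z → ℝ))
      ?_ ?_ ?_ ?_ (hu n)
    · rintro _ ⟨x, v, rfl⟩
      have : (RKHS.kerFun k.H x v : Z → ℝ) = fun z => v * k.toFun x z := by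
        ext z
        rw [RKHS.kerFun_apply, RKHS.OfKernel.kernel_ofKernel]
        simp [opMatrix, k.symm x z, mul_comm]
      rw [this]
      exact (hk.comp measurable_prodMk_left).const_mul v
    · simpa using measurable_zero
    · intro a b _ _ ha hb
      simpa using ha.add hb
    · intro r a _ ha
      simpa using ha.const_smul r
  · exact tendsto_pi_nhds.mpr fun x => ((RKHS.continuous_eval x).tendsto f).comp hlim

/-- Existence of the mean embedding for bounded measurable kernels and finite measures. -/
theorem PDKernel.meanEmbedding_apply {Z : Type*} [MeasurableSpace Z] (k : PDKernel Z)
    (hk : k.IsMeasurable) (hb : k.IsBounded) (P : Measure Z) [IsFiniteMeasure P] (x : Z) :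
    k.meanEmbedding P x = ∫ z, k.toFun x z ∂P := by
  obtain ⟨B, hB⟩ := hb
  have hdiag : ∀ z, ‖RKHS.kernel k.H z z‖ ≤ |B| := by
    intro z
    rw [RKHS.OfKernel.kernel_ofKernel]
    have h0 : 0 ≤ k.toFun z z := k.posSemidef.diag_nonneg (i := z)
    have h1 : k.toFun z z ≤ B := hB ⟨(z, z), rfl⟩
    have h2 : ‖k.opMatrix z z‖ = k.toFun z z := by
      simp [opMatrix, norm_smul, abs_of_nonneg h0]
    rw [h2]
    exact h1.trans (le_abs_self B)
  have hbound : ∀ (f : k.H) z, ‖f z‖ ≤ ‖f‖ * √|B| := fun f z =>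
    (RKHS.norm_apply_le f z).trans (by gcongr; exact hdiag z)
  have hint : ∀ f : k.H, Integrable f P := fun f =>
    Integrable.of_bound (k.measurable_coe hk f).aestronglyMeasurable (‖f‖ * √|B|)
      (Eventually.of_forall (hbound f))
  let φ : k.H →L[ℝ] ℝ := LinearMap.mkContinuous
    { toFun := fun f => ∫ z, f z ∂P
      map_add' := fun a b => by
        simp only [RKHS.coe_add, Pi.add_apply]
        exact integral_add (hint a) (hint b)
      map_smul' := fun r a => by
        simp only [RKHS.coe_smul, Pi.smul_apply, smul_eq_mul, RingHom.id_apply]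
        exact integral_const_mul r _ } (√|B| * P.real Set.univ) (fun f => by
        have := norm_integral_le_of_norm_le_const (μ := P) (Eventually.of_forall (hbound f))
        simp only [LinearMap.coe_mk, AddHom.coe_mk]
        linarith)
  have hex : ∃ f : k.H, ∀ x, f x = ∫ z, k.toFun x z ∂P := by
    refine ⟨(InnerProductSpace.toDual ℝ k.H).symm φ, fun x => ?_⟩
    have h1 := RKHS.inner_kerFun (𝕜 := ℝ) x (1 : ℝ) ((InnerProductSpace.toDual ℝ k.H).symm φ)
    rw [InnerProductSpace.toDual_symm_apply] at h1
    have h2 : φ (RKHS.kerFun k.H x (1 : ℝ)) = ∫ z, k.toFun x z ∂P :=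
      integral_congr_ae (Eventually.of_forall fun z => k.feature_apply x z)
    rw [h2] at h1
    simpa using h1.symm
  unfold meanEmbedding
  rw [dif_pos hex]
  exact hex.choose_spec x

/-- `MMD_k(P, Q) = ‖μ_P - μ_Q‖` in the RKHS of `k`. -/
def PDKernel.MMD {Z : Type*} [MeasurableSpace Z] (k : PDKernel Z) (P Q : Measure Z) : ℝ :=
  ‖k.meanEmbedding P - k.meanEmbedding Q‖

/-- `k` is characteristic: the MMD separates probability measures. -/
def PDKernel.IsCharacteristic {Z : Type*} [MeasurableSpace Z] (k : PDKernel Z) : Prop :=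
  ∀ P Q : Measure Z, IsProbabilityMeasure P → IsProbabilityMeasure Q → (k.MMD P Q = 0 ↔ P = Q)

/-- `MMD_{k²}(P, Q)`, where `k² = k ⊗ k`: the MMD for the kernel `k ⊗ k` between the images of `P`
and `Q` under the diagonal map `x ↦ (x, x)`. -/
def PDKernel.sqMMD {Z : Type*} [MeasurableSpace Z] (k : PDKernel Z) (P Q : Measure Z) : ℝ :=
  (k.tensor k).MMD (P.map fun z => (z, z)) (Q.map fun z => (z, z))

/-! ### The Dirichlet distribution and the Dirichlet process -/

/-- The Gamma(`a`, 1) law for `a > 0`; the point mass at `0` for `a = 0`. -/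
def gammaLaw (a : ℝ) : Measure ℝ := if 0 < a then gammaMeasure a 1 else Measure.dirac 0

/-- The Dirichlet distribution `Dir(a 0, …, a (r - 1))` for nonnegative parameters, not all zero:
the law of `(G i / ∑ j, G j)` where the `G i` are independent with `G i ∼ Gamma(a i, 1)`. -/
def dirichletLaw {r : ℕ} (a : Fin r → ℝ) : Measure (Fin r → ℝ) :=
  (Measure.pi fun i => gammaLaw (a i)).map fun G i => G i / ∑ j, G j

/-- `L` is the law of a Dirichlet process `DP(a, F)`: if `P ∼ L` then
`(P(A 0), …, P(A (r - 1))) ∼ Dir(a F(A 0), …, a F(A (r - 1)))` for every finite measurable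
partition (the partition `{Z}` forces `P` to be a probability measure almost surely). -/
def IsDirichletProcess {Z : Type*} [MeasurableSpace Z] (a : ℝ) (F : Measure Z)
    (L : Measure (Measure Z)) : Prop :=
  ∀ (r : ℕ) (A : Fin r → Set Z), (∀ i, MeasurableSet (A i)) →
    Pairwise (fun i j => Disjoint (A i) (A j)) → (⋃ i, A i) = Set.univ →
    L.map (fun P i => P.real (A i)) = dirichletLaw fun i => a * F.real (A i)

/-- Conditionally on the random element `D`, the random measures `P 0, …, P (n - 1)` are
independent, and `P i ∼ DP(a, F d i)` when `D = d`. -/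
def IsConditionallyIndepDP {Ω 𝓓 Z : Type*} [MeasurableSpace Ω] [MeasurableSpace 𝓓]
    [MeasurableSpace Z] {n : ℕ} (Pr : Measure Ω) (D : Ω → 𝓓) (a : ℝ) (F : 𝓓 → Fin n → Measure Z)
    (P : Fin n → Ω → Measure Z) : Prop :=
  ∃ κ : Kernel 𝓓 (Fin n → Measure Z), IsMarkovKernel κ ∧
    (∀ d, iIndepFun (fun (i : Fin n) (p : Fin n → Measure Z) => p i) (κ d)) ∧
    (∀ d i, IsDirichletProcess a (F d i) ((κ d).map fun p => p i)) ∧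
    HasCondDistrib (fun ω i => P i ω) D κ Pr

/-! ### Base measures, averages, and the loss -/

/-- The base measure `c/(c+m) Q + 1/(c+m) ∑ j, δ_{z j}` of a Dirichlet process posterior. -/
def dpBase {Z : Type*} [MeasurableSpace Z] {m : ℕ} (c : ℝ) (Q : Measure Z) (z : Fin m → Z) :
    Measure Z :=
  ENNReal.ofReal (c / (c + m)) • Q + ENNReal.ofReal (1 / (c + m)) • ∑ j, Measure.dirac (z j)

/-- The average `(1/n) ∑ i, P i`. -/
def avgMeasure {Z : Type*} [MeasurableSpace Z] {n : ℕ} (P : Fin n → Measure Z) : Measure Z :=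
  (n : ℝ≥0∞)⁻¹ • ∑ i, P i

/-- The observed data `𝒟` together with the pseudo-samples `S`, for sample size `n` and `m`
pseudo-samples per observation: `(W i, Y i)` for `i < n`, and `X̃ i j` for `i < n`, `j < m`. -/
abbrev DataSpace (𝓦 𝓧 𝓨 : Type*) (n m : ℕ) : Type _ := (Fin n → 𝓦 × 𝓨) × (Fin n → Fin m → 𝓧)

/-- The random element `(𝒟, S)`. -/
def dataSample {Ω 𝓦 𝓧 𝓨 : Type*} {n m : ℕ} (W : ℕ → Ω → 𝓦) (Y : ℕ → Ω → 𝓨)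
    (Xtilde : Fin n → Fin m → Ω → 𝓧) (ω : Ω) : DataSpace 𝓦 𝓧 𝓨 n m :=
  (fun i => (W i ω, Y i ω), fun i j => Xtilde i j ω)

/-- The base measures of the posteriors of `(X, Y) | W i`, as a function of `(𝒟, S)`. The prior
centring measures may depend on the observed data. -/
def baseXY {𝓦 𝓧 𝓨 : Type*} [MeasurableSpace 𝓦] [MeasurableSpace 𝓧] [MeasurableSpace 𝓨] {n m : ℕ}
    (c : ℝ) (Q : Fin n → Kernel (Fin n → 𝓦 × 𝓨) (𝓧 × 𝓨)) (d : DataSpace 𝓦 𝓧 𝓨 n m) (i : Fin n) :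
    Measure (𝓧 × 𝓨) :=
  dpBase c (Q i d.1) fun j => (d.2 i j, (d.1 i).2)

/-- The base measures of the posteriors of `X | W i`, as a function of `(𝒟, S)`. -/
def baseX {𝓦 𝓧 𝓨 : Type*} [MeasurableSpace 𝓦] [MeasurableSpace 𝓧] [MeasurableSpace 𝓨] {n m : ℕ}
    (c : ℝ) (Q : Fin n → Kernel (Fin n → 𝓦 × 𝓨) 𝓧) (d : DataSpace 𝓦 𝓧 𝓨 n m) (i : Fin n) :
    Measure 𝓧 :=
  dpBase c (Q i d.1) fun j => d.2 i j

/-- `MMD_k(P_{XY}, P_X P_{Y|X})` with `k = kX ⊗ kY`, where `P_X P_{Y|X}` is the joint law with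
`X`-marginal `P_X` and conditional law `P_{Y|X}` of `Y` given `X`. -/
def mmdLoss {𝓧 𝓨 : Type*} [MeasurableSpace 𝓧] [MeasurableSpace 𝓨] (kX : PDKernel 𝓧)
    (kY : PDKernel 𝓨) (PXY : Measure (𝓧 × 𝓨)) (PX : Measure 𝓧) (PYX : Kernel 𝓧 𝓨) : ℝ :=
  (kX.tensor kY).MMD PXY (PX ⊗ₘ PYX)

end MMDNPL

end

open MMDNPL

/-! The random loss converges to `M` uniformly over `Θ`, in probability, and a continuous loss on a
compact set with a unique minimiser then forces minimisers to converge. Uniformity holds because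
`|M_n(θ) - M(θ)|` is at most the `k`-discrepancy between the averaged joint draw and its limit plus
`a` times the `k_X²`-discrepancy between the averaged marginal draw and its limit, where `a` bounds
all `‖C_θ‖` (`abs_mmdLoss_sub_le`).

The operator enters through `MMD_compProd_le`. Attaching one conditional law to two marginals gives
a discrepancy equal to that of the kernel `k_X(x,x') ⟪C φ(x), C φ(x')⟫` on the marginals, with `φ`
the feature map. Subtracting it from `a² k_X²` leaves `k_X` times `a² ⟪φ(x), φ(x')⟫ - ⟪C φ(x), C
φ(x')⟫`, positive semidefinite by the Schur product theorem, and a larger kernel has a larger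
discrepancy.

The draws are close to their base measures by Chebyshev in the RKHS
(`IsConditionallyIndepDP.measure_MMD_ge_le`). Given the data they are independent with mean the base
measure (`IsDirichletProcess.bind_eq`, from the mean of a beta law), so the centred embeddings are
orthogonal in `L²` and their average has second moment at most `4B²/n`, whatever the data and the
concentration. The triangle inequality then passes to the assumed limits. -/

namespace MMDNPL

open scoped InnerProductSpace

/-! ### Calculus of mean embeddings and discrepancies. -/

namespace PDKernel

variable {Z : Type*}

theorem inner_feature_right (k : PDKernel Z) (f : k.H) (z : Z) : ⟪f, k.feature z⟫_ℝ = f z := by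
  simp [feature]

theorem inner_feature_feature (k : PDKernel Z) (x y : Z) :
    ⟪k.feature x, k.feature y⟫_ℝ = k.toFun x y := by
  rw [inner_feature_right, feature_apply]

theorem norm_feature_sq (k : PDKernel Z) (x : Z) : ‖k.feature x‖ ^ 2 = k.toFun x x := by
  rw [← real_inner_self_eq_norm_sq, inner_feature_feature]

/-- Boundedness is only from above; on the diagonal it bounds feature norms, and Cauchy–Schwarz
makes it two-sided. The constant is normalised so that `B` bounds features and `B ^ 2` the kernel.
-/
theorem IsBounded.exists_bound {k : PDKernel Z} (hb : k.IsBounded) :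
    ∃ B : ℝ, 0 ≤ B ∧ (∀ x, ‖k.feature x‖ ≤ B) ∧ ∀ x y, |k.toFun x y| ≤ B ^ 2 := by
  obtain ⟨B, hB⟩ := hb
  have h1 : ∀ x, ‖k.feature x‖ ≤ √|B| := fun x => by
    apply Real.le_sqrt_of_sq_le
    rw [norm_feature_sq]
    exact (hB ⟨(x, x), rfl⟩).trans (le_abs_self B)
  refine ⟨√|B|, Real.sqrt_nonneg _, h1, fun x y => ?_⟩
  rw [← inner_feature_feature, sq]
  exact (abs_real_inner_le_norm _ _).trans
    (mul_le_mul (h1 x) (h1 y) (norm_nonneg _) (Real.sqrt_nonneg _))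

theorem isBounded_of_abs_le {k : PDKernel Z} {B : ℝ} (h : ∀ x y, |k.toFun x y| ≤ B) :
    k.IsBounded :=
  ⟨B, by rintro _ ⟨p, rfl⟩; exact (abs_le.mp (h p.1 p.2)).2⟩

/-- The pullback of a kernel along a map. -/
def comap {Z' : Type*} (k : PDKernel Z) (f : Z' → Z) : PDKernel Z' where
  toFun x y := k.toFun (f x) (f y)
  posSemidef := k.posSemidef.submatrix f

theorem IsBounded.comap {Z' : Type*} {k : PDKernel Z}
    (hk : k.IsBounded) (f : Z' → Z) : (k.comap f).IsBounded := by
  obtain ⟨B, -, -, hB⟩ := hk.exists_bound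
  exact isBounded_of_abs_le (fun x y => hB (f x) (f y))

theorem IsBounded.tensor {X Y : Type*} {kX : PDKernel X} {kY : PDKernel Y} (hX : kX.IsBounded)
    (hY : kY.IsBounded) : (kX.tensor kY).IsBounded := by
  obtain ⟨B, -, -, hB⟩ := hX.exists_bound
  obtain ⟨B', -, -, hB'⟩ := hY.exists_bound
  refine isBounded_of_abs_le (B := B ^ 2 * B' ^ 2) fun x y => ?_
  simp only [PDKernel.tensor, abs_mul]
  exact mul_le_mul (hB _ _) (hB' _ _) (abs_nonneg _) (sq_nonneg _)

variable [MeasurableSpace Z]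

theorem integrable_coe {k : PDKernel Z} (hk : k.IsMeasurable) (hb : k.IsBounded) (f : k.H)
    (P : Measure Z) [IsFiniteMeasure P] : Integrable f P := by
  obtain ⟨B, -, hB, -⟩ := hb.exists_bound
  refine Integrable.of_bound (k.measurable_coe hk f).aestronglyMeasurable (‖f‖ * B)
    (Eventually.of_forall fun z => ?_)
  rw [← inner_feature_right]
  exact (norm_inner_le_norm _ _).trans (by gcongr; exact hB z)

/-- Integration against `P` is a bounded functional on the RKHS, and its Riesz representer has the
same point values as the mean embedding. -/
theorem inner_meanEmbedding_right {k : PDKernel Z} (hk : k.IsMeasurable) (hb : k.IsBounded)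
    (P : Measure Z) [IsFiniteMeasure P] (f : k.H) :
    ⟪f, k.meanEmbedding P⟫_ℝ = ∫ z, f z ∂P := by
  have hint : ∀ f : k.H, Integrable f P := fun f => integrable_coe hk hb f P
  obtain ⟨B, -, hB, -⟩ := hb.exists_bound
  let φ : k.H →L[ℝ] ℝ := LinearMap.mkContinuous
    { toFun := fun f => ∫ z, f z ∂P
      map_add' := fun a b => by
        simp only [RKHS.coe_add, Pi.add_apply]
        exact integral_add (hint a) (hint b)
      map_smul' := fun r a => by
        simp only [RKHS.coe_smul, Pi.smul_apply, smul_eq_mul, RingHom.id_apply]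
        exact integral_const_mul r _ } (B * P.real Set.univ) (fun f => by
        have hbd : ∀ z, ‖f z‖ ≤ ‖f‖ * B := fun z => by
          rw [← inner_feature_right]
          exact (norm_inner_le_norm _ _).trans (by gcongr; exact hB z)
        have := norm_integral_le_of_norm_le_const (μ := P) (Eventually.of_forall hbd)
        simp only [LinearMap.coe_mk, AddHom.coe_mk]
        linarith)
  have hφ : ∀ f, φ f = ∫ z, f z ∂P := fun f => rfl
  have heq : k.meanEmbedding P = (InnerProductSpace.toDual ℝ k.H).symm φ := by
    refine RKHS.ext (𝕜 := ℝ) fun x => ?_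
    rw [k.meanEmbedding_apply hk hb, ← inner_feature_right k _ x,
      InnerProductSpace.toDual_symm_apply, hφ]
    exact integral_congr_ae (Eventually.of_forall fun z => (k.feature_apply x z).symm)
  rw [heq, real_inner_comm, InnerProductSpace.toDual_symm_apply, hφ]

theorem inner_meanEmbedding {k : PDKernel Z} (hk : k.IsMeasurable) (hb : k.IsBounded)
    (P Q : Measure Z) [IsFiniteMeasure P] [IsFiniteMeasure Q] :
    ⟪k.meanEmbedding P, k.meanEmbedding Q⟫_ℝ = ∫ x, ∫ y, k.toFun x y ∂Q ∂P := by
  rw [real_inner_comm, inner_meanEmbedding_right hk hb]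
  simp_rw [k.meanEmbedding_apply hk hb]

/-- Embeddings for different kernels live in unrelated spaces; this form in double integrals is what
makes their discrepancies comparable. -/
theorem MMD_sq {k : PDKernel Z} (hk : k.IsMeasurable) (hb : k.IsBounded)
    (P Q : Measure Z) [IsFiniteMeasure P] [IsFiniteMeasure Q] :
    k.MMD P Q ^ 2 = (∫ x, ∫ y, k.toFun x y ∂P ∂P) - 2 * (∫ x, ∫ y, k.toFun x y ∂Q ∂P)
      + ∫ x, ∫ y, k.toFun x y ∂Q ∂Q := by
  simp_rw [← inner_meanEmbedding hk hb]
  rw [MMD, norm_sub_sq_real, real_inner_self_eq_norm_sq, real_inner_self_eq_norm_sq]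

theorem MMD_nonneg (k : PDKernel Z) (P Q : Measure Z) : 0 ≤ k.MMD P Q := norm_nonneg _

theorem MMD_triangle (k : PDKernel Z) (P Q R : Measure Z) :
    k.MMD P R ≤ k.MMD P Q + k.MMD Q R := norm_sub_le_norm_sub_add_norm_sub _ _ _

/-- Mass at most one, rather than exactly one, also covers the values of `massLeOneKernel`. -/
theorem norm_meanEmbedding_le {k : PDKernel Z} (hk : k.IsMeasurable) (hb : k.IsBounded) {B : ℝ}
    (hB0 : 0 ≤ B) (hB : ∀ x y, |k.toFun x y| ≤ B ^ 2) (P : Measure Z) [IsFiniteMeasure P]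
    (hP : P.real Set.univ ≤ 1) : ‖k.meanEmbedding P‖ ≤ B := by
  have h1 : ∀ x, ‖∫ y, k.toFun x y ∂P‖ ≤ B ^ 2 := fun x => by
    refine (norm_integral_le_of_norm_le_const (Eventually.of_forall (hB x))).trans ?_
    exact mul_le_of_le_one_right (sq_nonneg B) hP
  have h2 : ‖∫ x, ∫ y, k.toFun x y ∂P ∂P‖ ≤ B ^ 2 :=
    (norm_integral_le_of_norm_le_const (Eventually.of_forall h1)).trans
      (mul_le_of_le_one_right (sq_nonneg B) hP)
  rw [← inner_meanEmbedding hk hb, real_inner_self_eq_norm_sq] at h2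
  exact abs_le_of_sq_le_sq' ((le_abs_self _).trans h2) hB0 |>.2

theorem meanEmbedding_avgMeasure {k : PDKernel Z} (hk : k.IsMeasurable) (hb : k.IsBounded)
    {n : ℕ} (hn : n ≠ 0) (P : Fin n → Measure Z) [∀ i, IsFiniteMeasure (P i)] :
    k.meanEmbedding (avgMeasure P) = (n : ℝ)⁻¹ • ∑ i, k.meanEmbedding (P i) := by
  have hfin : IsFiniteMeasure (avgMeasure P) := by
    unfold avgMeasure
    refine Measure.smul_finite _ ?_
    simp [hn]
  refine ext_inner_left ℝ fun f => ?_
  rw [inner_meanEmbedding_right hk hb, inner_smul_right, inner_sum]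
  simp_rw [inner_meanEmbedding_right hk hb]
  rw [avgMeasure, integral_smul_measure, integral_finsetSum_measure
    (fun i _ => integrable_coe hk hb f (P i))]
  simp

theorem IsMeasurable.comap {Z' : Type*} [MeasurableSpace Z'] {k : PDKernel Z}
    (hk : k.IsMeasurable) {f : Z' → Z} (hf : Measurable f) : (k.comap f).IsMeasurable :=
  hk.comp (hf.prodMap hf)

theorem stronglyMeasurable_apply {k : PDKernel Z} (hk : k.IsMeasurable) (x : Z) :
    StronglyMeasurable (k.toFun x) :=
  (hk.comp measurable_prodMk_left).stronglyMeasurable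

theorem MMD_comap {Z' : Type*} [MeasurableSpace Z'] {k : PDKernel Z}
    (hk : k.IsMeasurable) (hb : k.IsBounded) {f : Z' → Z} (hf : Measurable f)
    (P Q : Measure Z') [IsFiniteMeasure P] [IsFiniteMeasure Q] :
    (k.comap f).MMD P Q = k.MMD (P.map f) (Q.map f) := by
  refine (sq_eq_sq₀ (MMD_nonneg _ _ _) (MMD_nonneg _ _ _)).mp ?_
  rw [MMD_sq (hk.comap hf) (hb.comap f), MMD_sq hk hb]
  have key : ∀ P Q : Measure Z', [IsFiniteMeasure P] → [IsFiniteMeasure Q] →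
      ∫ x, ∫ y, k.toFun x y ∂(Q.map f) ∂(P.map f) = ∫ x, ∫ y, (k.comap f).toFun x y ∂Q ∂P := by
    intro P Q _ _
    have h1 : ∀ x, ∫ y, k.toFun x y ∂(Q.map f) = ∫ y, k.toFun x (f y) ∂Q := fun x =>
      integral_map hf.aemeasurable (stronglyMeasurable_apply hk x).aestronglyMeasurable
    have hm : StronglyMeasurable fun x => ∫ y, k.toFun x (f y) ∂Q :=
      StronglyMeasurable.integral_prod_right
        (hk.comp (measurable_fst.prodMk (hf.comp measurable_snd))).stronglyMeasurable
    simp_rw [h1]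
    exact integral_map hf.aemeasurable hm.aestronglyMeasurable
  rw [key, key, key]

theorem IsMeasurable.tensor {X Y : Type*} [MeasurableSpace X] [MeasurableSpace Y]
    {kX : PDKernel X} {kY : PDKernel Y} (hX : kX.IsMeasurable) (hY : kY.IsMeasurable) :
    (kX.tensor kY).IsMeasurable :=
  (hX.comp ((measurable_fst.comp measurable_fst).prodMk (measurable_fst.comp measurable_snd))).mul
    (hY.comp ((measurable_snd.comp measurable_fst).prodMk (measurable_snd.comp measurable_snd)))

theorem integrable_apply {k : PDKernel Z} (hk : k.IsMeasurable) (hb : k.IsBounded)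
    (P : Measure Z) [IsFiniteMeasure P] (x : Z) : Integrable (k.toFun x) P := by
  obtain ⟨B, -, -, hB⟩ := hb.exists_bound
  exact Integrable.of_bound (stronglyMeasurable_apply hk x).aestronglyMeasurable _
    (Eventually.of_forall (hB x))

theorem integrable_integral {k : PDKernel Z} (hk : k.IsMeasurable) (hb : k.IsBounded)
    (P Q : Measure Z) [IsFiniteMeasure P] [IsFiniteMeasure Q] :
    Integrable (fun x => ∫ y, k.toFun x y ∂Q) P := by
  simp_rw [← k.meanEmbedding_apply hk hb]
  exact integrable_coe hk hb _ P

/-- If `a k' - k` is positive-definite, the discrepancy of `k` is bounded by that of `k'`. -/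
theorem MMD_le_of_sub_posSemidef {k k' : PDKernel Z} (hk : k.IsMeasurable) (hb : k.IsBounded)
    (hk' : k'.IsMeasurable) (hb' : k'.IsBounded) {a : ℝ} (ha : 0 ≤ a)
    (h : (Matrix.of fun x y => a ^ 2 * k'.toFun x y - k.toFun x y).PosSemidef)
    (P Q : Measure Z) [IsFiniteMeasure P] [IsFiniteMeasure Q] :
    k.MMD P Q ≤ a * k'.MMD P Q := by
  -- The squared discrepancy is linear in the kernel, so that of `d` is the difference of the two
  -- sides squared, and it is nonnegative.
  let d : PDKernel Z := ⟨fun x y => a ^ 2 * k'.toFun x y - k.toFun x y, h⟩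
  have hdm : d.IsMeasurable := (Measurable.const_mul hk' _).sub hk
  have hdb : d.IsBounded := by
    obtain ⟨B, -, -, hB⟩ := hb.exists_bound
    obtain ⟨B', -, -, hB'⟩ := hb'.exists_bound
    refine isBounded_of_abs_le (B := a ^ 2 * B' ^ 2 + B ^ 2) fun x y => ?_
    refine (abs_sub _ _).trans (add_le_add ?_ (hB x y))
    rw [abs_mul, abs_of_nonneg (sq_nonneg a)]
    exact mul_le_mul_of_nonneg_left (hB' x y) (sq_nonneg a)
  have key : ∀ P Q : Measure Z, [IsFiniteMeasure P] → [IsFiniteMeasure Q] →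
      ∫ x, ∫ y, d.toFun x y ∂Q ∂P
        = a ^ 2 * (∫ x, ∫ y, k'.toFun x y ∂Q ∂P) - ∫ x, ∫ y, k.toFun x y ∂Q ∂P := by
    intro P Q _ _
    have h1 : ∀ x, ∫ y, d.toFun x y ∂Q
        = a ^ 2 * (∫ y, k'.toFun x y ∂Q) - ∫ y, k.toFun x y ∂Q := fun x => by
      rw [← integral_const_mul]
      exact integral_sub ((integrable_apply hk' hb' Q x).const_mul _) (integrable_apply hk hb Q x)
    simp_rw [h1]
    rw [← integral_const_mul]
    exact integral_sub ((integrable_integral hk' hb' P Q).const_mul _)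
      (integrable_integral hk hb P Q)
  have h0 := sq_nonneg (d.MMD P Q)
  rw [MMD_sq hdm hdb, key, key, key] at h0
  refine abs_le_of_sq_le_sq' ?_ (mul_nonneg ha (MMD_nonneg _ _ _)) |>.2
  rw [mul_pow, MMD_sq hk hb, MMD_sq hk' hb']
  linarith

end PDKernel

end MMDNPL

/-! ### Operator domination and the cost of attaching a conditional law. -/

namespace MMDNPL

open scoped InnerProductSpace

theorem posSemidef_of_forall_sum_nonneg {X : Type*} {K : X → X → ℝ} (hs : ∀ x y, K x y = K y x)
    (h : ∀ v : X →₀ ℝ, 0 ≤ v.sum fun i a => v.sum fun j b => a * K i j * b) :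
    (Matrix.of K).PosSemidef := by
  refine ⟨?_, fun v => by simpa using h v⟩
  ext x y
  simp [hs x y]

theorem sum_mul_inner_mul {X E : Type*} [NormedAddCommGroup E] [InnerProductSpace ℝ E]
    (u : X → E) (v : X →₀ ℝ) :
    (v.sum fun i a => v.sum fun j b => a * ⟪u i, u j⟫_ℝ * b) = ‖v.sum fun i a => a • u i‖ ^ 2 := by
  rw [← real_inner_self_eq_norm_sq]
  simp only [Finsupp.sum, inner_sum, sum_inner, inner_smul_left, inner_smul_right,
    RCLike.conj_to_real]
  simp only [Finset.mul_sum]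
  rw [Finset.sum_comm]
  exact Finset.sum_congr rfl fun i _ => Finset.sum_congr rfl fun j _ => by ring

theorem posSemidef_inner {X E : Type*} [NormedAddCommGroup E] [InnerProductSpace ℝ E] (u : X → E) :
    (Matrix.of fun x y => ⟪u x, u y⟫_ℝ).PosSemidef :=
  posSemidef_of_forall_sum_nonneg (fun x y => real_inner_comm _ _)
    fun v => by rw [sum_mul_inner_mul]; positivity

/-- The quadratic form at `v` is `a² ‖s‖² - ‖C s‖²` with `s = ∑ v i • u i`. -/
theorem posSemidef_sub_inner_map {X E F : Type*} [NormedAddCommGroup E] [InnerProductSpace ℝ E]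
    [NormedAddCommGroup F] [InnerProductSpace ℝ F] (u : X → E) (C : E →L[ℝ] F) {a : ℝ}
    (hC : ‖C‖ ≤ a) :
    (Matrix.of fun x y => a ^ 2 * ⟪u x, u y⟫_ℝ - ⟪C (u x), C (u y)⟫_ℝ).PosSemidef := by
  refine posSemidef_of_forall_sum_nonneg (fun x y => ?_) fun v => ?_
  · rw [real_inner_comm (u x), real_inner_comm (C (u x))]
  · have h1 : (v.sum fun i s => v.sum fun j t =>
        s * (a ^ 2 * ⟪u i, u j⟫_ℝ - ⟪C (u i), C (u j)⟫_ℝ) * t)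
        = a ^ 2 * ‖v.sum fun i s => s • u i‖ ^ 2 - ‖C (v.sum fun i s => s • u i)‖ ^ 2 := by
      have h2 : C (v.sum fun i s => s • u i) = v.sum fun i s => s • C (u i) := by
        simp [Finsupp.sum, map_sum]
      rw [h2, ← sum_mul_inner_mul, ← sum_mul_inner_mul]
      simp only [Finsupp.sum, Finset.mul_sum, ← Finset.sum_sub_distrib]
      exact Finset.sum_congr rfl fun i _ => Finset.sum_congr rfl fun j _ => by ring
    rw [h1, ← mul_pow, sub_nonneg]
    refine pow_le_pow_left₀ (norm_nonneg _) ((C.le_opNorm _).trans ?_) 2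
    gcongr

variable {X Y : Type*} [MeasurableSpace X] [MeasurableSpace Y]

/-- The RKHS is not assumed separable, so measurability is only claimed for scalar products of
embeddings, which are iterated kernel integrals. Later second-moment computations are phrased
through such products. -/
theorem stronglyMeasurable_inner_meanEmbedding {T Z : Type*} [MeasurableSpace T]
    [MeasurableSpace Z] {k : PDKernel Z} (hk : k.IsMeasurable) (hb : k.IsBounded)
    (η ζ : Kernel T Z) [IsFiniteKernel η] [IsFiniteKernel ζ] :
    StronglyMeasurable fun t => ⟪k.meanEmbedding (η t), k.meanEmbedding (ζ t)⟫_ℝ := by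
  simp_rw [PDKernel.inner_meanEmbedding hk hb]
  have h1 : StronglyMeasurable fun p : T × Z => ∫ y, k.toFun p.2 y ∂(ζ.prodMkRight Z p) :=
    StronglyMeasurable.integral_kernel_prod_right
      (f := fun (p : T × Z) y => k.toFun p.2 y)
      (hk.comp ((measurable_snd.comp measurable_fst).prodMk measurable_snd)).stronglyMeasurable
  exact StronglyMeasurable.integral_kernel_prod_right
    (f := fun t x => ∫ y, k.toFun x y ∂(ζ t)) h1

/-- Disintegrating both joint laws and exchanging `y` with `x'` brings the two response integrals
together, where they form an inner product of conditional embeddings. -/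
theorem integral_tensor_compProd {kX : PDKernel X} {kY : PDKernel Y} (hX : kX.IsMeasurable)
    (hY : kY.IsMeasurable) (hXb : kX.IsBounded) (hYb : kY.IsBounded) (κ : Kernel X Y)
    [IsMarkovKernel κ] (P Q : Measure X) [IsFiniteMeasure P] [IsFiniteMeasure Q] :
    ∫ z, ∫ w, (kX.tensor kY).toFun z w ∂(Q ⊗ₘ κ) ∂(P ⊗ₘ κ)
      = ∫ x, ∫ x', kX.toFun x x' * ⟪kY.meanEmbedding (κ x), kY.meanEmbedding (κ x')⟫_ℝ ∂Q ∂P := by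
  obtain ⟨B, -, -, hB⟩ := hXb.exists_bound
  obtain ⟨B', -, -, hB'⟩ := hYb.exists_bound
  have hm := hX.tensor hY
  have hb := hXb.tensor hYb
  rw [Measure.integral_compProd (PDKernel.integrable_integral hm hb _ _)]
  refine integral_congr_ae (Eventually.of_forall fun x => ?_)
  have h1 : ∀ y, ∫ w, (kX.tensor kY).toFun (x, y) w ∂(Q ⊗ₘ κ)
      = ∫ x', kX.toFun x x' * ∫ y', kY.toFun y y' ∂(κ x') ∂Q := fun y => by
    rw [Measure.integral_compProd (PDKernel.integrable_apply hm hb _ _)]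
    simp only [PDKernel.tensor, integral_const_mul]
  simp only [h1]
  rw [integral_integral_swap]
  · refine integral_congr_ae (Eventually.of_forall fun x' => ?_)
    simp only [integral_const_mul, PDKernel.inner_meanEmbedding hY hYb]
  · have h2 : StronglyMeasurable fun p : Y × X =>
        ∫ y', kY.toFun p.1 y' ∂(κ.prodMkLeft Y p) :=
      StronglyMeasurable.integral_kernel_prod_right
        (f := fun (p : Y × X) y' => kY.toFun p.1 y')
        (hY.comp ((measurable_fst.comp measurable_fst).prodMk measurable_snd)).stronglyMeasurable
    have h3 : StronglyMeasurable fun p : Y × X => kX.toFun x p.2 :=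
      (hX.comp (measurable_const.prodMk measurable_snd)).stronglyMeasurable
    refine Integrable.of_bound (C := B ^ 2 * B' ^ 2) (h3.mul h2).aestronglyMeasurable
      (Eventually.of_forall fun p => ?_)
    change ‖kX.toFun x p.2 * ∫ y', kY.toFun p.1 y' ∂(κ p.2)‖ ≤ _
    rw [norm_mul]
    refine mul_le_mul (hB _ _) ?_ (norm_nonneg _) (sq_nonneg _)
    refine (norm_integral_le_of_norm_le_const (Eventually.of_forall (hB' p.1))).trans ?_
    simp

/-- If the conditional mean embedding of `κ` extends to an operator of norm at most `a`, then
attaching `κ` to two laws costs at most a factor `a` relative to their `k²`-discrepancy. -/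
theorem MMD_compProd_le {kX : PDKernel X} {kY : PDKernel Y} (hX : kX.IsMeasurable)
    (hY : kY.IsMeasurable) (hXb : kX.IsBounded) (hYb : kY.IsBounded) (κ : Kernel X Y)
    [IsMarkovKernel κ] (C : kX.H →L[ℝ] kY.H)
    (hC : ∀ x, C (kX.feature x) = kY.meanEmbedding (κ x)) {a : ℝ} (ha : ‖C‖ ≤ a)
    (P Q : Measure X) [IsFiniteMeasure P] [IsFiniteMeasure Q] :
    (kX.tensor kY).MMD (P ⊗ₘ κ) (Q ⊗ₘ κ) ≤ a * kX.sqMMD P Q := by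
  have ha0 : 0 ≤ a := (norm_nonneg C).trans ha
  have hdiag : Measurable fun x : X => (x, x) := measurable_id.prodMk measurable_id
  obtain ⟨B, -, -, hB⟩ := hXb.exists_bound
  obtain ⟨B', hB'0, -, hB'⟩ := hYb.exists_bound
  -- The response is integrated out into this kernel, so the discrepancy of the joint laws becomes
  -- one of their marginals.
  let k : PDKernel X :=
    ⟨fun x y => kX.toFun x y * ⟪C (kX.feature x), C (kX.feature y)⟫_ℝ,
      kX.posSemidef.hadamard (posSemidef_inner fun x => C (kX.feature x))⟩
  have hk : k.IsMeasurable := by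
    refine Measurable.mul hX ?_
    simp_rw [hC]
    exact (stronglyMeasurable_inner_meanEmbedding hY hYb (κ.comap Prod.fst measurable_fst)
      (κ.comap Prod.snd measurable_snd)).measurable
  have hkb : k.IsBounded := by
    refine PDKernel.isBounded_of_abs_le (B := B ^ 2 * (B' * B')) fun x y => ?_
    have hn : ∀ x, ‖C (kX.feature x)‖ ≤ B' := fun x => by
      rw [hC]
      exact PDKernel.norm_meanEmbedding_le hY hYb hB'0 hB' _ (by simp)
    simp only [k, abs_mul]
    refine mul_le_mul (hB x y) ?_ (abs_nonneg _) (sq_nonneg _)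
    exact (abs_real_inner_le_norm _ _).trans (mul_le_mul (hn x) (hn y) (norm_nonneg _) hB'0)
  have h1 : (kX.tensor kY).MMD (P ⊗ₘ κ) (Q ⊗ₘ κ) = k.MMD P Q := by
    refine (sq_eq_sq₀ (PDKernel.MMD_nonneg _ _ _) (PDKernel.MMD_nonneg _ _ _)).mp ?_
    rw [PDKernel.MMD_sq (hX.tensor hY) (hXb.tensor hYb), PDKernel.MMD_sq hk hkb]
    simp_rw [integral_tensor_compProd hX hY hXb hYb, ← hC]
    rfl
  rw [h1, PDKernel.sqMMD, ← PDKernel.MMD_comap (hX.tensor hX) (hXb.tensor hXb) hdiag]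
  refine PDKernel.MMD_le_of_sub_posSemidef hk hkb ((hX.tensor hX).comap hdiag)
    ((hXb.tensor hXb).comap _) ha0 ?_ P Q
  -- Schur product theorem: `a² k_X² - k` factors as `k_X` times a positive semidefinite kernel.
  have h2 := kX.posSemidef.hadamard (posSemidef_sub_inner_map kX.feature C ha)
  have h3 : (Matrix.of fun x y => a ^ 2 * ((kX.tensor kX).comap fun x => (x, x)).toFun x y
      - k.toFun x y) = (Matrix.of kX.toFun).hadamard (Matrix.of fun x y =>
        a ^ 2 * ⟪kX.feature x, kX.feature y⟫_ℝ - ⟪C (kX.feature x), C (kX.feature y)⟫_ℝ) := by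
    ext x y
    simp only [Matrix.of_apply, Matrix.hadamard_apply, PDKernel.comap, PDKernel.tensor, k,
      PDKernel.inner_feature_feature]
    ring
  rw [h3]
  exact h2

end MMDNPL

/-! ### Gamma variables and the mean of a two-cell Dirichlet law. -/

namespace MMDNPL

theorem measurable_gammaPDF (a r : ℝ) : Measurable (gammaPDF a r) :=
  (measurable_gammaPDFReal a r).ennreal_ofReal

instance isProbabilityMeasure_gammaLaw (a : ℝ) : IsProbabilityMeasure (gammaLaw a) := by
  unfold gammaLaw
  split_ifs with h
  · exact isProbabilityMeasure_gammaMeasure h one_pos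
  · infer_instance

theorem ae_pos_gammaLaw {a : ℝ} (ha : 0 < a) : ∀ᵐ x ∂gammaLaw a, 0 < x := by
  rw [gammaLaw, if_pos ha, gammaMeasure,
    ae_withDensity_iff (measurable_gammaPDF a 1)]
  have h0 : ∀ᵐ x : ℝ, x ≠ 0 := by simp [ae_iff]
  filter_upwards [h0] with x hx h
  by_contra! hneg
  exact h (gammaPDF_of_neg (lt_of_le_of_ne hneg hx))

theorem ae_nonneg_gammaLaw (a : ℝ) : ∀ᵐ x ∂gammaLaw a, 0 ≤ x := by
  by_cases ha : 0 < a
  · exact (ae_pos_gammaLaw ha).mono fun _ h => h.le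
  · rw [gammaLaw, if_neg ha, ae_dirac_eq]
    exact le_refl (0 : ℝ)

/-- Exponential tilting turns the Gamma(`a`, 1) density into a multiple of the Gamma(`a`, `1 + t`)
density, which has mass one. -/
theorem lintegral_exp_gammaLaw {a t : ℝ} (ha : 0 ≤ a) (ht : 0 ≤ t) :
    ∫⁻ x, ENNReal.ofReal (Real.exp (-(t * x))) ∂gammaLaw a
      = ENNReal.ofReal ((1 + t) ^ (-a)) := by
  have ht1 : 0 < 1 + t := by linarith
  rcases ha.eq_or_lt with rfl | ha
  · simp [gammaLaw]
  rw [gammaLaw, if_pos ha, gammaMeasure, lintegral_withDensity_eq_lintegral_mul _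
    (measurable_gammaPDF a 1) (by fun_prop)]
  have key : ∀ x, (gammaPDF a 1 * fun x => ENNReal.ofReal (Real.exp (-(t * x)))) x
      = ENNReal.ofReal ((1 + t) ^ (-a)) * gammaPDF a (1 + t) x := by
    intro x
    rcases lt_or_ge x 0 with hx | hx
    · simp [gammaPDF_of_neg hx]
    · rw [Pi.mul_apply, gammaPDF_of_nonneg hx, gammaPDF_of_nonneg hx,
        ← ENNReal.ofReal_mul (by positivity), ← ENNReal.ofReal_mul (by positivity)]
      congr 1
      rw [Real.rpow_neg ht1.le, show -((1 + t) * x) = -(1 * x) + -(t * x) by ring, Real.exp_add]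
      have := (Real.rpow_pos_of_pos ht1 a).ne'
      field_simp
      simp
  simp_rw [key]
  rw [lintegral_const_mul _ (measurable_gammaPDF a (1 + t)),
    lintegral_gammaPDF_eq_one ha ht1, mul_one]

/-- The extra factor `x` raises the shape by one, and `Γ(a + 1) = a Γ(a)` produces the factor `a`.
-/
theorem lintegral_mul_exp_gammaLaw {a t : ℝ} (ha : 0 ≤ a) (ht : 0 ≤ t) :
    ∫⁻ x, ENNReal.ofReal (x * Real.exp (-(t * x))) ∂gammaLaw a
      = ENNReal.ofReal (a * (1 + t) ^ (-(a + 1))) := by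
  have ht1 : 0 < 1 + t := by linarith
  rcases ha.eq_or_lt with rfl | ha
  · simp [gammaLaw]
  rw [gammaLaw, if_pos ha, gammaMeasure, lintegral_withDensity_eq_lintegral_mul _
    (measurable_gammaPDF a 1) (by fun_prop)]
  have h0 : ∀ᵐ x : ℝ, x ≠ 0 := by simp [ae_iff]
  have key : ∀ᵐ x, (gammaPDF a 1 * fun x => ENNReal.ofReal (x * Real.exp (-(t * x)))) x
      = ENNReal.ofReal (a * (1 + t) ^ (-(a + 1))) * gammaPDF (a + 1) (1 + t) x := by
    filter_upwards [h0] with x hx0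
    rcases lt_or_ge x 0 with hx | hx
    · simp [gammaPDF_of_neg hx]
    · have hxp : 0 < x := lt_of_le_of_ne hx hx0.symm
      rw [Pi.mul_apply, gammaPDF_of_nonneg hx, gammaPDF_of_nonneg hx,
        ← ENNReal.ofReal_mul (by positivity), ← ENNReal.ofReal_mul (by positivity)]
      congr 1
      rw [Real.rpow_neg ht1.le, show -((1 + t) * x) = -(1 * x) + -(t * x) by ring, Real.exp_add,
        Real.Gamma_add_one ha.ne', show a + 1 - 1 = (a - 1) + 1 by ring,
        Real.rpow_add_one hx0]
      have := (Real.rpow_pos_of_pos ht1 (a + 1)).ne'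
      have := (Real.Gamma_pos_of_pos ha).ne'
      field_simp
      simp
  rw [lintegral_congr_ae key,
    lintegral_const_mul _ (measurable_gammaPDF (a + 1) (1 + t)),
    lintegral_gammaPDF_eq_one (by linarith) ht1, mul_one]

/-- Applied with `s = x + y`, this replaces the denominator of a ratio by exponentials that factor
over `x` and `y`. -/
theorem lintegral_exp_neg_mul {s : ℝ} (hs : 0 < s) :
    ∫⁻ t in Set.Ici 0, ENNReal.ofReal (Real.exp (-(s * t))) = ENNReal.ofReal s⁻¹ := by
  have h1 : ∀ t, ENNReal.ofReal s⁻¹ * gammaPDF 1 s t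
      = (Set.Ici 0).indicator (fun t => ENNReal.ofReal (Real.exp (-(s * t)))) t := by
    intro t
    rcases lt_or_ge t 0 with ht | ht
    · simp [gammaPDF_of_neg ht, ht]
    · rw [Set.indicator_of_mem (Set.mem_Ici.mpr ht), gammaPDF_of_nonneg ht,
        ← ENNReal.ofReal_mul (by positivity)]
      simp [hs.ne']
  rw [← lintegral_indicator measurableSet_Ici]
  simp_rw [← h1]
  rw [lintegral_const_mul _ (measurable_gammaPDF 1 s),
    lintegral_gammaPDF_eq_one one_pos hs, mul_one]

/-- By Tonelli the two transforms multiply; the integral left over depends on the shapes only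
through `a + b`. -/
theorem lintegral_ratio_gammaLaw_aux {a b : ℝ} (ha : 0 ≤ a) (hb : 0 ≤ b) :
    ∫⁻ x, ∫⁻ y, ENNReal.ofReal (x / (x + y)) ∂gammaLaw b ∂gammaLaw a
      = ENNReal.ofReal a *
        ∫⁻ t in Set.Ici (0 : ℝ), ENNReal.ofReal ((1 + t) ^ (-(a + b + 1))) := by
  have h1 : ∀ᵐ x ∂gammaLaw a, ∫⁻ y, ENNReal.ofReal (x / (x + y)) ∂gammaLaw b
      = ∫⁻ t in Set.Ici (0 : ℝ), ENNReal.ofReal (x * Real.exp (-(t * x))) *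
          ENNReal.ofReal ((1 + t) ^ (-b)) := by
    filter_upwards [ae_nonneg_gammaLaw a] with x hx
    rcases hx.eq_or_lt with rfl | hx
    · simp
    calc ∫⁻ y, ENNReal.ofReal (x / (x + y)) ∂gammaLaw b
        = ∫⁻ y, (∫⁻ t in Set.Ici (0 : ℝ), ENNReal.ofReal (x * Real.exp (-(t * x))) *
          ENNReal.ofReal (Real.exp (-(t * y)))) ∂gammaLaw b := by
          refine lintegral_congr_ae ?_
          filter_upwards [ae_nonneg_gammaLaw b] with y hy
          rw [div_eq_mul_inv, ENNReal.ofReal_mul hx.le, ← lintegral_exp_neg_mul (by linarith),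
            ← lintegral_const_mul _ (by fun_prop)]
          refine lintegral_congr fun t => ?_
          rw [ENNReal.ofReal_mul hx.le, mul_assoc,
            ← ENNReal.ofReal_mul (Real.exp_nonneg (-(t * x))), ← Real.exp_add]
          congr 4
          ring
      _ = ∫⁻ t in Set.Ici (0 : ℝ), ∫⁻ y, ENNReal.ofReal (x * Real.exp (-(t * x))) *
          ENNReal.ofReal (Real.exp (-(t * y))) ∂gammaLaw b :=
          lintegral_lintegral_swap (by fun_prop)
      _ = _ := by
          refine setLIntegral_congr_fun measurableSet_Ici fun t ht => ?_
          rw [lintegral_const_mul _ (by fun_prop), lintegral_exp_gammaLaw hb ht]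
  have h2 : AEMeasurable (Function.uncurry fun x t : ℝ => ENNReal.ofReal (x * Real.exp (-(t * x))) *
      ENNReal.ofReal ((1 + t) ^ (-b))) ((gammaLaw a).prod (volume.restrict (Set.Ici 0))) := by
    fun_prop
  rw [lintegral_congr_ae h1, lintegral_lintegral_swap h2, ← lintegral_const_mul _ (by fun_prop)]
  refine setLIntegral_congr_fun measurableSet_Ici fun t (ht : 0 ≤ t) => ?_
  have ht1 : 0 < 1 + t := by linarith
  rw [lintegral_mul_const _ (by fun_prop), lintegral_mul_exp_gammaLaw ha ht,
    ← ENNReal.ofReal_mul (by positivity), ← ENNReal.ofReal_mul ha, mul_assoc,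
    ← Real.rpow_add ht1]
  congr 3
  ring

/-- The mean of the beta law, as the ratio of independent gamma variables. -/
theorem lintegral_ratio_gammaLaw {a b : ℝ} (ha : 0 ≤ a) (hb : 0 ≤ b) (hab : 0 < a + b) :
    ∫⁻ x, ∫⁻ y, ENNReal.ofReal (x / (x + y)) ∂gammaLaw b ∂gammaLaw a
      = ENNReal.ofReal (a / (a + b)) := by
  -- The leftover integral need not be computed: with shapes `a + b` and `0` the ratio is almost
  -- surely `1`, which determines its value.
  have h0 := lintegral_ratio_gammaLaw_aux hab.le le_rfl
  have h1 : ∫⁻ x, ∫⁻ y, ENNReal.ofReal (x / (x + y)) ∂gammaLaw 0 ∂gammaLaw (a + b) = 1 := by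
    have h2 : gammaLaw 0 = Measure.dirac 0 := by simp [gammaLaw]
    have h3 : ∀ᵐ x ∂gammaLaw (a + b),
        ∫⁻ y, ENNReal.ofReal (x / (x + y)) ∂gammaLaw 0 = 1 := by
      filter_upwards [ae_pos_gammaLaw hab] with x hx
      rw [h2, lintegral_dirac]
      simp [hx.ne']
    rw [lintegral_congr_ae h3]
    simp
  rw [h1, add_zero] at h0
  rw [lintegral_ratio_gammaLaw_aux ha hb, div_eq_mul_inv, ENNReal.ofReal_mul ha,
    ENNReal.ofReal_inv_of_pos hab]
  congr 1
  refine ENNReal.eq_inv_of_mul_eq_one_left ?_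
  rw [mul_comm]
  exact h0.symm

theorem lintegral_dirichletLaw_two (a : Fin 2 → ℝ) (ha : ∀ i, 0 ≤ a i) (hpos : 0 < a 0 + a 1) :
    ∫⁻ v, ENNReal.ofReal (v 0) ∂dirichletLaw a = ENNReal.ofReal (a 0 / (a 0 + a 1)) := by
  have hm : Measurable fun (G : Fin 2 → ℝ) i => G i / ∑ j, G j := by fun_prop
  rw [dirichletLaw, lintegral_map (by fun_prop) hm,
    ← lintegral_ratio_gammaLaw (ha 0) (ha 1) hpos]
  have h1 := (measurePreserving_piFinTwo fun i => gammaLaw (a i)).lintegral_comp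
    (f := fun p : ℝ × ℝ => ENNReal.ofReal (p.1 / (p.1 + p.2))) (by fun_prop)
  rw [lintegral_prod _ (by fun_prop)] at h1
  rw [← h1]
  refine lintegral_congr fun G => ?_
  simp [Fin.sum_univ_two, MeasurableEquiv.piFinTwo]

theorem ae_dirichletLaw_one (a : Fin 1 → ℝ) (ha : 0 < a 0) : ∀ᵐ v ∂dirichletLaw a, v 0 = 1 := by
  have hm : Measurable fun (G : Fin 1 → ℝ) i => G i / ∑ j, G j := by fun_prop
  rw [dirichletLaw, ae_map_iff hm.aemeasurable
    (measurableSet_eq_fun (by fun_prop) (by fun_prop))]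
  have h1 : ∀ᵐ G ∂Measure.pi fun i => gammaLaw (a i), 0 < G 0 :=
    (Measure.quasiMeasurePreserving_eval (μ := fun i => gammaLaw (a i)) 0).ae (ae_pos_gammaLaw ha)
  filter_upwards [h1] with G hG
  simp [hG.ne']

end MMDNPL

/-! ### Mean of a Dirichlet process and second moments of independent sums. -/

namespace MMDNPL

open scoped InnerProductSpace

variable {Z : Type*} [MeasurableSpace Z]

/-- The identity on measures of total mass at most one, as a finite kernel. -/
noncomputable def massLeOneKernel (Z : Type*) [MeasurableSpace Z] : Kernel (Measure Z) Z where
  -- Heavier measures go to `0`. Almost every Dirichlet process draw is unaffected, while bounds and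
  -- finiteness now hold everywhere.
  toFun := {P : Measure Z | P Set.univ ≤ 1}.indicator id
  measurable' := measurable_id.indicator
    (measurableSet_le (Measure.measurable_coe MeasurableSet.univ) measurable_const)

theorem massLeOneKernel_apply_univ_le (P : Measure Z) : massLeOneKernel Z P Set.univ ≤ 1 := by
  change ({P : Measure Z | P Set.univ ≤ 1}.indicator id P) Set.univ ≤ 1
  by_cases h : P ∈ {P : Measure Z | P Set.univ ≤ 1}
  · rw [Set.indicator_of_mem h]; exact h
  · rw [Set.indicator_of_notMem h]; simp

theorem massLeOneKernel_apply (P : Measure Z) [IsProbabilityMeasure P] :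
    massLeOneKernel Z P = P :=
  Set.indicator_of_mem (s := {P : Measure Z | P Set.univ ≤ 1}) (f := id) prob_le_one

instance isFiniteKernel_massLeOneKernel : IsFiniteKernel (massLeOneKernel Z) :=
  ⟨⟨1, ENNReal.one_lt_top, massLeOneKernel_apply_univ_le⟩⟩

theorem massLeOneKernel_real_univ_le (P : Measure Z) : (massLeOneKernel Z P).real Set.univ ≤ 1 :=
  ENNReal.toReal_le_of_le_ofReal zero_le_one (by simpa using massLeOneKernel_apply_univ_le P)

theorem measurable_measureReal {A : Set Z} (hA : MeasurableSet A) :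
    Measurable fun P : Measure Z => P.real A :=
  (Measure.measurable_coe hA).ennreal_toReal

theorem IsDirichletProcess.ae_isProbabilityMeasure {a : ℝ} (ha : 0 < a) {F : Measure Z}
    [IsProbabilityMeasure F] {L : Measure (Measure Z)} (hL : IsDirichletProcess a F L) :
    ∀ᵐ P ∂L, IsProbabilityMeasure P := by
  have h1 := hL 1 (fun _ => Set.univ) (fun _ => MeasurableSet.univ)
    (fun i j hij => absurd (Subsingleton.elim i j) hij) (Set.iUnion_const _)
  have h2 : ∀ᵐ v ∂L.map (fun P (_ : Fin 1) => P.real Set.univ), v 0 = 1 := by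
    rw [h1]
    exact ae_dirichletLaw_one _ (by simpa using ha)
  have hm : Measurable fun (P : Measure Z) (_ : Fin 1) => P.real Set.univ :=
    measurable_pi_lambda _ fun _ => measurable_measureReal MeasurableSet.univ
  filter_upwards [ae_of_ae_map hm.aemeasurable h2] with P hP
  -- Infinite mass is excluded too, since its real value is `0`.
  exact ⟨(ENNReal.toReal_eq_one_iff _).mp hP⟩

/-- The mean measure of a Dirichlet process is its base measure. -/
theorem IsDirichletProcess.bind_eq {a : ℝ} (ha : 0 < a) {F : Measure Z}
    [IsProbabilityMeasure F] {L : Measure (Measure Z)} (hL : IsDirichletProcess a F L) :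
    L.bind (massLeOneKernel Z) = F := by
  ext A hA
  -- For the partition into `A` and its complement the first Dirichlet coordinate has mean `a F(A) /
  -- a`.
  have h1 := hL 2 ![A, Aᶜ] (by simp [Fin.forall_fin_two, hA])
    (by
      intro i j hij
      fin_cases i <;> fin_cases j <;> simp_all [disjoint_compl_right, disjoint_compl_left])
    (by
      ext x
      simp [Fin.exists_fin_two, Classical.em])
  have hm : Measurable fun (P : Measure Z) (i : Fin 2) => P.real (![A, Aᶜ] i) :=
    measurable_pi_lambda _ fun i => measurable_measureReal (by fin_cases i <;> simp [hA])
  have hsum : F.real A + F.real Aᶜ = 1 := by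
    rw [measureReal_add_measureReal_compl hA, probReal_univ]
  have h2 := lintegral_dirichletLaw_two (fun i => a * F.real (![A, Aᶜ] i))
    (fun i => mul_nonneg ha.le measureReal_nonneg)
    (by simpa [← mul_add, hsum] using ha)
  rw [← h1, lintegral_map (by fun_prop) hm] at h2
  simp only [Matrix.cons_val_zero, Matrix.cons_val_one, ← mul_add, hsum, mul_one] at h2
  rw [mul_div_cancel_left₀ _ ha.ne', ofReal_measureReal] at h2
  rw [Measure.bind_apply hA (Kernel.aemeasurable _), ← h2]
  refine lintegral_congr_ae ?_
  filter_upwards [hL.ae_isProbabilityMeasure ha] with P hP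
  rw [massLeOneKernel_apply, ofReal_measureReal]

section Variance

variable {k : PDKernel Z}

theorem stronglyMeasurable_inner_sub (hk : k.IsMeasurable) (hb : k.IsBounded) {T : Type*}
    [MeasurableSpace T] (η ζ η' ζ' : Kernel T Z) [IsFiniteKernel η] [IsFiniteKernel ζ]
    [IsFiniteKernel η'] [IsFiniteKernel ζ'] :
    StronglyMeasurable fun t => ⟪k.meanEmbedding (η t) - k.meanEmbedding (ζ t),
      k.meanEmbedding (η' t) - k.meanEmbedding (ζ' t)⟫_ℝ := by
  simp only [inner_sub_left, inner_sub_right]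
  have h := fun (α β : Kernel T Z) [IsFiniteKernel α] [IsFiniteKernel β] =>
    stronglyMeasurable_inner_meanEmbedding hk hb α β
  exact ((h η η').sub (h ζ η')).sub ((h η ζ').sub (h ζ ζ'))

variable {α : Type*} [MeasurableSpace α] (K : Kernel α Z) [IsFiniteKernel K]

/-- The weak form of "the mean embedding has mean the embedding of `F`"; testing against a fixed
vector avoids an RKHS-valued integral. -/
theorem integral_inner_meanEmbedding (hk : k.IsMeasurable) (hb : k.IsBounded) {L : Measure α}
    [IsProbabilityMeasure L] {F : Measure Z} [IsProbabilityMeasure F] (hF : L.bind K = F)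
    (v : k.H) :
    ∫ a, ⟪v, k.meanEmbedding (K a)⟫_ℝ ∂L = ⟪v, k.meanEmbedding F⟫_ℝ := by
  simp_rw [PDKernel.inner_meanEmbedding_right hk hb]
  have h1 := Kernel.integral_comp (κ := Kernel.const Unit L) (η := K) (a := ()) (f := v)
  rw [← Measure.comp_eq_comp_const_apply, hF] at h1
  exact (h1 (PDKernel.integrable_coe hk hb v F)).symm

theorem norm_sub_meanEmbedding_le (hk : k.IsMeasurable) (hb : k.IsBounded) {B : ℝ} (hB0 : 0 ≤ B)
    (hB : ∀ x y, |k.toFun x y| ≤ B ^ 2) (P F : Measure Z) [IsFiniteMeasure P] [IsFiniteMeasure F]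
    (hP : P.real Set.univ ≤ 1) (hF : F.real Set.univ ≤ 1) :
    ‖k.meanEmbedding P - k.meanEmbedding F‖ ≤ 2 * B := by
  have h1 := PDKernel.norm_meanEmbedding_le hk hb hB0 hB P hP
  have h2 := PDKernel.norm_meanEmbedding_le hk hb hB0 hB F hF
  linarith [norm_sub_le (k.meanEmbedding P) (k.meanEmbedding F)]

/-- By Fubini, with the first coordinate fixed the second factor averages to zero; centring under
the second law suffices. -/
theorem integral_inner_sub_prod_eq_zero (hk : k.IsMeasurable) (hb : k.IsBounded)
    (hK : ∀ a, (K a).real Set.univ ≤ 1) {L L' : Measure α}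
    [IsProbabilityMeasure L] [IsProbabilityMeasure L'] {F F' : Measure Z} [IsProbabilityMeasure F]
    [IsProbabilityMeasure F'] (hF' : L'.bind K = F') :
    ∫ p, ⟪k.meanEmbedding (K p.1) - k.meanEmbedding F,
      k.meanEmbedding (K p.2) - k.meanEmbedding F'⟫_ℝ ∂(L.prod L') = 0 := by
  obtain ⟨B, hB0, -, hB⟩ := hb.exists_bound
  have hn := fun (P F : Measure Z) [IsFiniteMeasure P] [IsFiniteMeasure F] hP hF =>
    norm_sub_meanEmbedding_le hk hb hB0 hB P F hP hF
  have hm := stronglyMeasurable_inner_sub hk hb (K.comap Prod.fst measurable_fst)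
    (Kernel.const (α × α) F) (K.comap Prod.snd measurable_snd) (Kernel.const (α × α) F')
  simp only [Kernel.comap_apply, Kernel.const_apply] at hm
  rw [integral_prod]
  · refine (integral_congr_ae (Eventually.of_forall fun a => ?_)).trans (integral_zero _ _)
    have hint : Integrable (fun b => ⟪k.meanEmbedding (K a) - k.meanEmbedding F,
        k.meanEmbedding (K b)⟫_ℝ) L' := by
      -- The zero measure, whose embedding is `0`, reduces the second difference to a single
      -- embedding.
      have h1 := stronglyMeasurable_inner_sub hk hb (Kernel.const α (K a))
        (Kernel.const α F) K (Kernel.const α 0)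
      have h0 : k.meanEmbedding (0 : Measure Z) = 0 :=
        ext_inner_left ℝ fun f => by
          rw [PDKernel.inner_meanEmbedding_right hk hb]
          simp
      simp only [Kernel.const_apply, h0, sub_zero] at h1
      refine Integrable.of_bound (C := 2 * B * B) h1.aestronglyMeasurable
        (Eventually.of_forall fun b => (norm_inner_le_norm _ _).trans ?_)
      exact mul_le_mul (hn _ _ (hK a) (by simp))
        (PDKernel.norm_meanEmbedding_le hk hb hB0 hB _ (hK b)) (norm_nonneg _) (by positivity)
    simp only [inner_sub_right (k.meanEmbedding (K a) - k.meanEmbedding F)]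
    rw [integral_sub hint (integrable_const _), integral_inner_meanEmbedding K hk hb hF']
    simp
  · refine Integrable.of_bound (C := 2 * B * (2 * B)) hm.aestronglyMeasurable
      (Eventually.of_forall fun p => (norm_inner_le_norm _ _).trans ?_)
    exact mul_le_mul (hn _ _ (hK _) (by simp)) (hn _ _ (hK _) (by simp)) (norm_nonneg _)
      (by positivity)

theorem norm_sum_sq_eq {E : Type*} [NormedAddCommGroup E] [InnerProductSpace ℝ E] {n : ℕ}
    (u : Fin n → E) : ‖∑ i, u i‖ ^ 2 = ∑ i, ∑ j, ⟪u i, u j⟫_ℝ := by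
  rw [← real_inner_self_eq_norm_sq, sum_inner]
  simp_rw [inner_sum]

/-- The second moment of a sum of independent centred mean embeddings grows linearly. -/
theorem integral_norm_sum_sq_le (hk : k.IsMeasurable) (hb : k.IsBounded) {B : ℝ} (hB0 : 0 ≤ B)
    (hB : ∀ x y, |k.toFun x y| ≤ B ^ 2) (hK : ∀ a, (K a).real Set.univ ≤ 1) {n : ℕ}
    {μ : Measure (Fin n → α)} [IsProbabilityMeasure μ]
    (hμ : iIndepFun (fun (i : Fin n) (p : Fin n → α) => p i) μ) (F : Fin n → Measure Z)
    [∀ i, IsProbabilityMeasure (F i)] (hF : ∀ i, (μ.map fun p => p i).bind K = F i) :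
    ∫ p, ‖∑ i, (k.meanEmbedding (K (p i)) - k.meanEmbedding (F i))‖ ^ 2 ∂μ
      ≤ n * (2 * B) ^ 2 := by
  have hn := fun (P F : Measure Z) [IsFiniteMeasure P] [IsFiniteMeasure F] hP hF =>
    norm_sub_meanEmbedding_le hk hb hB0 hB P F hP hF
  have hbd : ∀ (p : Fin n → α) i j, ‖⟪k.meanEmbedding (K (p i)) - k.meanEmbedding (F i),
      k.meanEmbedding (K (p j)) - k.meanEmbedding (F j)⟫_ℝ‖ ≤ (2 * B) ^ 2 := fun p i j => by
    rw [sq]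
    exact (norm_inner_le_norm _ _).trans (mul_le_mul (hn _ _ (hK _) (by simp))
      (hn _ _ (hK _) (by simp)) (norm_nonneg _) (by positivity))
  have hint : ∀ i j, Integrable (fun p : Fin n → α =>
      ⟪k.meanEmbedding (K (p i)) - k.meanEmbedding (F i),
        k.meanEmbedding (K (p j)) - k.meanEmbedding (F j)⟫_ℝ) μ := fun i j =>
    Integrable.of_bound (stronglyMeasurable_inner_sub hk hb
      (K.comap (fun p : Fin n → α => p i) (measurable_pi_apply i))
      (Kernel.const (Fin n → α) (F i))
      (K.comap (fun p : Fin n → α => p j) (measurable_pi_apply j))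
      (Kernel.const (Fin n → α) (F j))).aestronglyMeasurable _
      (Eventually.of_forall fun p => hbd p i j)
  have hoff : ∀ i j, i ≠ j → ∫ p, ⟪k.meanEmbedding (K (p i)) - k.meanEmbedding (F i),
      k.meanEmbedding (K (p j)) - k.meanEmbedding (F j)⟫_ℝ ∂μ = 0 := fun i j hij => by
    have h1 := (indepFun_iff_map_prod_eq_prod_map_map (measurable_pi_apply i).aemeasurable
      (measurable_pi_apply j).aemeasurable).mp (hμ.indepFun hij)
    have : IsProbabilityMeasure (μ.map fun p => p i) :=
      Measure.isProbabilityMeasure_map (measurable_pi_apply i).aemeasurable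
    have : IsProbabilityMeasure (μ.map fun p => p j) :=
      Measure.isProbabilityMeasure_map (measurable_pi_apply j).aemeasurable
    have h2 := integral_inner_sub_prod_eq_zero K hk hb hK (L := μ.map fun p => p i)
      (F := F i) (hF j)
    rw [← h1, integral_map (by fun_prop)] at h2
    · exact h2
    · exact (stronglyMeasurable_inner_sub hk hb (K.comap Prod.fst measurable_fst)
        (Kernel.const (α × α) (F i)) (K.comap Prod.snd measurable_snd)
        (Kernel.const (α × α) (F j))).aestronglyMeasurable
  simp_rw [norm_sum_sq_eq]
  rw [integral_finsetSum _ fun i _ => integrable_finsetSum _ fun j _ => hint i j]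
  -- Independence has removed the cross terms, so each row keeps only its diagonal entry.
  have hrow : ∀ i, ∫ p, ∑ j, ⟪k.meanEmbedding (K (p i)) - k.meanEmbedding (F i),
      k.meanEmbedding (K (p j)) - k.meanEmbedding (F j)⟫_ℝ ∂μ ≤ (2 * B) ^ 2 := fun i => by
    rw [integral_finsetSum _ fun j _ => hint i j,
      Finset.sum_eq_single i (fun j _ hj => hoff i j hj.symm) (by simp)]
    refine (le_abs_self _).trans ((norm_integral_le_of_norm_le_const
      (Eventually.of_forall fun p => hbd p i i)).trans ?_)
    simp
  calc _ ≤ ∑ _i : Fin n, (2 * B) ^ 2 := Finset.sum_le_sum fun i _ => hrow i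
    _ = n * (2 * B) ^ 2 := by simp

end Variance

end MMDNPL

/-! ### Concentration of averaged Dirichlet process draws. -/

namespace MMDNPL

open scoped InnerProductSpace

variable {Z : Type*} [MeasurableSpace Z]

theorem isProbabilityMeasure_avgMeasure {n : ℕ} (hn : n ≠ 0) (P : Fin n → Measure Z)
    [∀ i, IsProbabilityMeasure (P i)] : IsProbabilityMeasure (avgMeasure P) := by
  refine ⟨?_⟩
  simp only [avgMeasure, Measure.smul_apply, Measure.finsetSum_apply, measure_univ,
    Finset.sum_const, Finset.card_univ, Fintype.card_fin, smul_eq_mul, nsmul_eq_mul, mul_one]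
  exact ENNReal.inv_mul_cancel (by simpa using hn) (ENNReal.natCast_ne_top n)

theorem isProbabilityMeasure_dpBase {m : ℕ} (hm : 1 ≤ m) {c : ℝ} (hc : 0 ≤ c) (Q : Measure Z)
    [IsProbabilityMeasure Q] (z : Fin m → Z) : IsProbabilityMeasure (dpBase c Q z) := by
  have hm' : (1 : ℝ) ≤ m := by exact_mod_cast hm
  have hpos : 0 < c + m := by linarith
  refine ⟨?_⟩
  simp only [dpBase, Measure.add_apply, Measure.smul_apply, Measure.finsetSum_apply, measure_univ,
    Finset.sum_const, Finset.card_univ, Fintype.card_fin, smul_eq_mul, nsmul_eq_mul, mul_one]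
  rw [← ENNReal.ofReal_natCast, ← ENNReal.ofReal_mul (by positivity),
    ← ENNReal.ofReal_add (by positivity) (by positivity), ENNReal.ofReal_eq_one]
  field_simp

theorem measurable_dpBase {T : Type*} [MeasurableSpace T] {m : ℕ} (c : ℝ) {Q : T → Measure Z}
    (hQ : Measurable Q) {z : T → Fin m → Z} (hz : ∀ j, Measurable fun t => z t j) :
    Measurable fun t => dpBase c (Q t) (z t) := by
  refine Measure.measurable_of_measurable_coe _ fun s hs => ?_
  simp only [dpBase, Measure.add_apply, Measure.smul_apply, Measure.finsetSum_apply, smul_eq_mul]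
  refine Measurable.add (((Measure.measurable_coe hs).comp hQ).const_mul _)
    ((Finset.measurable_fun_sum _ fun j _ => ?_).const_mul _)
  exact (Measure.measurable_coe hs).comp (Measure.measurable_dirac.comp (hz j))

theorem IsConditionallyIndepDP.ae_isProbabilityMeasure {Ω 𝓓 : Type*} [MeasurableSpace Ω]
    [MeasurableSpace 𝓓] {n : ℕ} {Pr : Measure Ω} {D : Ω → 𝓓} {a : ℝ}
    (ha : 0 < a) {F : 𝓓 → Fin n → Measure Z} (hFp : ∀ d i, IsProbabilityMeasure (F d i))
    {P : Fin n → Ω → Measure Z} [IsFiniteMeasure Pr] (h : IsConditionallyIndepDP Pr D a F P) :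
    ∀ᵐ ω ∂Pr, ∀ i, IsProbabilityMeasure (P i ω) := by
  obtain ⟨κ, hκ, -, hDP, hlaw⟩ := h
  have hset : MeasurableSet {Q : Measure Z | IsProbabilityMeasure Q} := by
    have : {Q : Measure Z | IsProbabilityMeasure Q} = {Q : Measure Z | Q Set.univ = 1} := by
      ext Q
      exact isProbabilityMeasure_iff
    rw [this]
    exact (Measure.measurable_coe MeasurableSet.univ) (measurableSet_singleton 1)
  rw [ae_all_iff]
  intro i
  have h1 : ∀ᵐ t ∂(Pr.map D) ⊗ₘ κ, IsProbabilityMeasure (t.2 i) := by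
    refine Measure.ae_compProd_of_ae_ae ?_ (Eventually.of_forall fun d => ?_)
    · exact ((measurable_pi_apply i).comp measurable_snd) hset
    · have := hFp d i
      exact ae_of_ae_map (measurable_pi_apply i).aemeasurable
        ((hDP d i).ae_isProbabilityMeasure ha)
  rw [← hlaw.map_eq] at h1
  exact ae_of_ae_map hlaw.aemeasurable h1

/-- The averaged Dirichlet process draws concentrate around the averaged base measure. -/
theorem IsConditionallyIndepDP.measure_MMD_ge_le {Ω 𝓓 : Type*} [MeasurableSpace Ω]
    [MeasurableSpace 𝓓] {n : ℕ} (hn : n ≠ 0) {Pr : Measure Ω} [IsProbabilityMeasure Pr]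
    {D : Ω → 𝓓} {a : ℝ} (ha : 0 < a) {F : 𝓓 → Fin n → Measure Z}
    (hFm : ∀ i, Measurable fun d => F d i) (hFp : ∀ d i, IsProbabilityMeasure (F d i))
    {P : Fin n → Ω → Measure Z} (h : IsConditionallyIndepDP Pr D a F P)
    {k : PDKernel Z} (hk : k.IsMeasurable) (hb : k.IsBounded) {B : ℝ} (hB0 : 0 ≤ B)
    (hB : ∀ x y, |k.toFun x y| ≤ B ^ 2) {ε : ℝ} (hε : 0 < ε) :
    Pr {ω | ε ≤ k.MMD (avgMeasure fun i => P i ω) (avgMeasure (F (D ω)))}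
      ≤ ENNReal.ofReal ((2 * B) ^ 2 / ε ^ 2 / n) := by
  have hprob := h.ae_isProbabilityMeasure ha hFp
  obtain ⟨κ, hκ, hind, hDP, hlaw⟩ := h
  have hn0 : (0 : ℝ) < n := by positivity
  -- Truncation by `massLeOneKernel` makes the deviations bounded at every pair of data and draws,
  -- not just almost surely.
  let u : 𝓓 × (Fin n → Measure Z) → Fin n → k.H := fun t i =>
    k.meanEmbedding (massLeOneKernel Z (t.2 i)) - k.meanEmbedding (F t.1 i)
  let Fk : Fin n → Kernel 𝓓 Z := fun i => ⟨fun d => F d i, hFm i⟩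
  have hFk : ∀ i, IsMarkovKernel (Fk i) := fun i => ⟨fun d => hFp d i⟩
  have hum : StronglyMeasurable fun t => ‖∑ i, u t i‖ ^ 2 := by
    simp_rw [norm_sum_sq_eq]
    refine Finset.stronglyMeasurable_fun_sum _ fun i _ =>
      Finset.stronglyMeasurable_fun_sum _ fun j _ => ?_
    exact stronglyMeasurable_inner_sub hk hb
      ((massLeOneKernel Z).comap (fun t : 𝓓 × (Fin n → Measure Z) => t.2 i)
        ((measurable_pi_apply i).comp measurable_snd))
      ((Fk i).comap Prod.fst measurable_fst)
      ((massLeOneKernel Z).comap (fun t : 𝓓 × (Fin n → Measure Z) => t.2 j)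
        ((measurable_pi_apply j).comp measurable_snd))
      ((Fk j).comap Prod.fst measurable_fst)
  have hD : IsProbabilityMeasure (Pr.map D) :=
    Measure.isProbabilityMeasure_map hlaw.aemeasurable_fst
  have hint : Integrable (fun t => ‖∑ i, u t i‖ ^ 2) ((Pr.map D) ⊗ₘ κ) := by
    refine Integrable.of_bound (C := (n * (2 * B)) ^ 2) hum.aestronglyMeasurable
      (Eventually.of_forall fun t => ?_)
    rw [norm_pow, norm_norm]
    refine pow_le_pow_left₀ (norm_nonneg _) ((norm_sum_le _ _).trans ?_) 2
    refine (Finset.sum_le_sum fun i _ => ?_).trans (b := ∑ _i : Fin n, 2 * B) (by simp)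
    exact norm_sub_meanEmbedding_le hk hb hB0 hB _ _ (massLeOneKernel_real_univ_le _) (by simp)
  have hmean : ∫ t, ‖∑ i, u t i‖ ^ 2 ∂((Pr.map D) ⊗ₘ κ) ≤ n * (2 * B) ^ 2 := by
    rw [Measure.integral_compProd hint]
    have h1 : ∀ d, ∫ p, ‖∑ i, u (d, p) i‖ ^ 2 ∂(κ d) ≤ n * (2 * B) ^ 2 := fun d =>
      integral_norm_sum_sq_le (massLeOneKernel Z) hk hb hB0 hB massLeOneKernel_real_univ_le
        (hind d) (F d) fun i => (hDP d i).bind_eq ha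
    calc _ ≤ ∫ _d, (n * (2 * B) ^ 2 : ℝ) ∂(Pr.map D) :=
          integral_mono hint.integral_compProd (integrable_const _) h1
      _ = _ := by simp
  -- The threshold is `(n ε)²` because the discrepancy of averages is `n⁻¹` times the norm of the
  -- sum.
  have hmarkov := mul_meas_ge_le_integral_of_nonneg (μ := (Pr.map D) ⊗ₘ κ)
    (Eventually.of_forall fun t => sq_nonneg ‖∑ i, u t i‖) hint ((n * ε) ^ 2)
  have hle : ((Pr.map D) ⊗ₘ κ).real {t | (n * ε) ^ 2 ≤ ‖∑ i, u t i‖ ^ 2}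
      ≤ (2 * B) ^ 2 / ε ^ 2 / n := by
    rw [div_div, le_div_iff₀ (by positivity)]
    have h2 := hmarkov.trans hmean
    have h3 : (n : ℝ) * (((Pr.map D) ⊗ₘ κ).real {t | (n * ε) ^ 2 ≤ ‖∑ i, u t i‖ ^ 2}
        * (ε ^ 2 * n)) ≤ n * (2 * B) ^ 2 := by
      refine le_of_eq_of_le ?_ h2
      ring
    exact le_of_mul_le_mul_left h3 hn0
  have hset : MeasurableSet {t : 𝓓 × (Fin n → Measure Z) | (n * ε) ^ 2 ≤ ‖∑ i, u t i‖ ^ 2} :=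
    measurableSet_le measurable_const hum.measurable
  calc Pr {ω | ε ≤ k.MMD (avgMeasure fun i => P i ω) (avgMeasure (F (D ω)))}
      ≤ Pr ((fun ω => (D ω, fun i => P i ω)) ⁻¹' {t | (n * ε) ^ 2 ≤ ‖∑ i, u t i‖ ^ 2}) := by
        refine measure_mono_ae ?_
        -- Off a null set the draws are probability measures, so the truncation in `u` does nothing.
        filter_upwards [hprob] with ω hω hωε
        have hF' := hFp (D ω)
        change (n * ε) ^ 2 ≤ ‖∑ i, u (D ω, fun i => P i ω) i‖ ^ 2
        have h4 : k.MMD (avgMeasure fun i => P i ω) (avgMeasure (F (D ω)))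
            = (n : ℝ)⁻¹ * ‖∑ i, u (D ω, fun i => P i ω) i‖ := by
          rw [PDKernel.MMD, PDKernel.meanEmbedding_avgMeasure hk hb hn,
            PDKernel.meanEmbedding_avgMeasure hk hb hn, ← smul_sub, norm_smul,
            ← Finset.sum_sub_distrib, norm_inv, RCLike.norm_natCast]
          simp only [u, massLeOneKernel_apply]
        have h5 : ε ≤ (n : ℝ)⁻¹ * ‖∑ i, u (D ω, fun i => P i ω) i‖ := h4 ▸ hωε
        refine pow_le_pow_left₀ (by positivity) ?_ 2
        rwa [inv_mul_eq_div, le_div_iff₀ hn0, mul_comm] at h5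
    _ = ((Pr.map D) ⊗ₘ κ) {t | (n * ε) ^ 2 ≤ ‖∑ i, u t i‖ ^ 2} := by
        rw [← hlaw.map_eq, Measure.map_apply_of_aemeasurable hlaw.aemeasurable hset]
    _ ≤ _ := by
        rw [← ofReal_measureReal]
        exact ENNReal.ofReal_le_ofReal hle

/-- The Chebyshev bound involves neither the data nor `a n`, so the factor `1/n` alone drives the
limit and `a n` may vary freely. -/
theorem tendstoInMeasure_MMD_avgMeasure {Ω : Type*} [MeasurableSpace Ω] {𝓓 : ℕ → Type*}
    [∀ n, MeasurableSpace (𝓓 n)] {Pr : Measure Ω} [IsProbabilityMeasure Pr]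
    {D : ∀ n, Ω → 𝓓 n} {a : ℕ → ℝ} (ha : ∀ n, 0 < a n) {F : ∀ n, 𝓓 n → Fin n → Measure Z}
    (hFm : ∀ n i, Measurable fun d => F n d i) (hFp : ∀ n d i, IsProbabilityMeasure (F n d i))
    {P : ∀ n, Fin n → Ω → Measure Z} (h : ∀ n, IsConditionallyIndepDP Pr (D n) (a n) (F n) (P n))
    {k : PDKernel Z} (hk : k.IsMeasurable) (hb : k.IsBounded) :
    TendstoInMeasure Pr (fun n ω => k.MMD (avgMeasure fun i => P n i ω)
      (avgMeasure (F n (D n ω)))) atTop fun _ => 0 := by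
  obtain ⟨B, hB0, -, hB⟩ := hb.exists_bound
  rw [tendstoInMeasure_iff_norm]
  intro ε hε
  have hlim : Tendsto (fun n : ℕ => ENNReal.ofReal ((2 * B) ^ 2 / ε ^ 2 / n)) atTop (𝓝 0) := by
    rw [← ENNReal.ofReal_zero]
    exact ENNReal.tendsto_ofReal (tendsto_const_div_atTop_nhds_zero_nat _)
  refine tendsto_of_tendsto_of_tendsto_of_le_of_le' tendsto_const_nhds hlim
    (Eventually.of_forall fun _ => zero_le) ?_
  filter_upwards [eventually_ne_atTop 0] with n hn
  simp only [sub_zero, Real.norm_of_nonneg (PDKernel.MMD_nonneg _ _ _)]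
  exact (h n).measure_MMD_ge_le hn (ha n) (hFm n) (hFp n) hk hb hB0 hB hε

/-! ### Convergence in probability and minimisers. -/

/-- Only monotonicity and subadditivity of outer measure are involved, so the losses and
discrepancies need not be measurable in `ω`. -/
theorem tendstoInMeasure_zero_of_le_add {Ω : Type*} [MeasurableSpace Ω] {Pr : Measure Ω}
    {f g h : ℕ → Ω → ℝ} (hf0 : ∀ n ω, 0 ≤ f n ω)
    (hfgh : ∀ᶠ n in atTop, ∀ᵐ ω ∂Pr, f n ω ≤ g n ω + h n ω)
    (hg : TendstoInMeasure Pr g atTop fun _ => 0) (hh : TendstoInMeasure Pr h atTop fun _ => 0) :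
    TendstoInMeasure Pr f atTop fun _ => 0 := by
  rw [tendstoInMeasure_iff_norm] at hg hh ⊢
  intro ε hε
  have hlim := (hg (ε / 2) (by positivity)).add (hh (ε / 2) (by positivity))
  rw [add_zero] at hlim
  refine tendsto_of_tendsto_of_tendsto_of_le_of_le' tendsto_const_nhds hlim
    (Eventually.of_forall fun _ => zero_le) ?_
  filter_upwards [hfgh] with n hn
  refine (measure_mono_ae ?_).trans (measure_union_le _ _)
  filter_upwards [hn] with ω hω hωε
  change ε ≤ ‖f n ω - 0‖ at hωε
  change ε / 2 ≤ ‖g n ω - 0‖ ∨ ε / 2 ≤ ‖h n ω - 0‖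
  rw [sub_zero, Real.norm_of_nonneg (hf0 n ω)] at hωε
  by_contra! hcon
  simp only [sub_zero] at hcon
  linarith [Real.le_norm_self (g n ω), Real.le_norm_self (h n ω)]

theorem tendstoInMeasure_const_mul_zero {Ω : Type*} [MeasurableSpace Ω] {Pr : Measure Ω}
    {f : ℕ → Ω → ℝ} {a : ℝ} (ha : 0 < a) (hf : TendstoInMeasure Pr f atTop fun _ => 0) :
    TendstoInMeasure Pr (fun n ω => a * f n ω) atTop fun _ => 0 := by
  rw [tendstoInMeasure_iff_norm] at hf ⊢
  intro ε hε
  refine (hf (ε / a) (by positivity)).congr fun n => ?_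
  congr 1
  ext ω
  change ε / a ≤ ‖f n ω - 0‖ ↔ ε ≤ ‖a * f n ω - 0‖
  rw [sub_zero, sub_zero, norm_mul, Real.norm_of_nonneg ha.le, div_le_iff₀' ha]

/-- Consistency of minimisers under uniform convergence in probability to a continuous loss on a
compact set with a unique minimiser. -/
theorem tendstoInMeasure_argmin {Ω E : Type*} [MeasurableSpace Ω] [PseudoMetricSpace E]
    {Pr : Measure Ω} {Θ : Set E} (hΘ : IsCompact Θ) {M : E → ℝ} (hM : ContinuousOn M Θ) {θ₀ : E}
    (hθ₀ : θ₀ ∈ Θ) (hmin : ∀ θ ∈ Θ, θ ≠ θ₀ → M θ₀ < M θ) {Mn : ℕ → Ω → E → ℝ}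
    {θn : ℕ → Ω → E} {R : ℕ → Ω → ℝ}
    (hθn : ∀ n, ∀ᵐ ω ∂Pr, θn n ω ∈ Θ ∧ IsMinOn (Mn n ω) Θ (θn n ω))
    (hMn : ∀ᶠ n in atTop, ∀ᵐ ω ∂Pr, ∀ θ ∈ Θ, |Mn n ω θ - M θ| ≤ R n ω)
    (hR : TendstoInMeasure Pr R atTop fun _ => 0) :
    TendstoInMeasure Pr θn atTop fun _ => θ₀ := by
  rw [tendstoInMeasure_iff_dist]
  rw [tendstoInMeasure_iff_norm] at hR
  intro ε hε
  -- Compactness gives a uniform gap: `M` attains its minimum on the part of `Θ` at distance at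
  -- least `ε`. If that part is empty, any `δ` serves.
  obtain ⟨δ, hδ, hsep⟩ : ∃ δ > 0, ∀ θ ∈ Θ, ε ≤ dist θ θ₀ → M θ₀ + δ ≤ M θ := by
    have hK : IsCompact (Θ ∩ {θ | ε ≤ dist θ θ₀}) :=
      hΘ.inter_right (isClosed_le continuous_const (continuous_id.dist continuous_const))
    rcases (Θ ∩ {θ | ε ≤ dist θ θ₀}).eq_empty_or_nonempty with he | hne
    · exact ⟨1, one_pos, fun θ h1 h2 => absurd ⟨h1, h2⟩ (Set.eq_empty_iff_forall_notMem.mp he θ)⟩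
    · obtain ⟨θ₁, hθ₁, h1⟩ := hK.exists_isMinOn hne (hM.mono Set.inter_subset_left)
      have hne' : θ₁ ≠ θ₀ := by
        rintro rfl
        have : ε ≤ dist θ₁ θ₁ := hθ₁.2
        rw [dist_self] at this
        linarith
      refine ⟨M θ₁ - M θ₀, sub_pos.mpr (hmin θ₁ hθ₁.1 hne'), fun θ h2 h3 => ?_⟩
      have : M θ₁ ≤ M θ := h1 ⟨h2, h3⟩
      linarith
  refine tendsto_of_tendsto_of_tendsto_of_le_of_le' tendsto_const_nhds
    (hR (δ / 2) (by positivity)) (Eventually.of_forall fun _ => zero_le) ?_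
  filter_upwards [hMn] with n hn
  refine measure_mono_ae ?_
  filter_upwards [hn, hθn n] with ω h1 h2 h3
  -- The error is paid twice, at the minimiser and at `θ₀`: `δ ≤ M (θn) - M θ₀ ≤ 2 R`.
  change δ / 2 ≤ ‖R n ω - 0‖
  have h4 := hsep _ h2.1 h3
  have h5 : Mn n ω (θn n ω) ≤ Mn n ω θ₀ := h2.2 hθ₀
  have h6 := abs_le.mp (h1 _ h2.1)
  have h7 := abs_le.mp (h1 _ hθ₀)
  rw [sub_zero]
  linarith [Real.le_norm_self (R n ω)]

end MMDNPL

/-! ### Uniform comparison of the losses and the conclusion. -/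

namespace MMDNPL

/-- The kernel `k²` on `Z`, as the pullback of `k ⊗ k` along the diagonal. -/
def PDKernel.square {Z : Type*} (k : PDKernel Z) : PDKernel Z := (k.tensor k).comap fun z => (z, z)

theorem measurable_diag (Z : Type*) [MeasurableSpace Z] : Measurable fun z : Z => (z, z) :=
  measurable_id.prodMk measurable_id

theorem PDKernel.IsMeasurable.square {Z : Type*} [MeasurableSpace Z] {k : PDKernel Z}
    (hk : k.IsMeasurable) : k.square.IsMeasurable :=
  (hk.tensor hk).comap (measurable_diag Z)

theorem PDKernel.IsBounded.square {Z : Type*} {k : PDKernel Z} (hb : k.IsBounded) :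
    k.square.IsBounded :=
  (hb.tensor hb).comap _

theorem PDKernel.sqMMD_eq {Z : Type*} [MeasurableSpace Z] {k : PDKernel Z} (hk : k.IsMeasurable)
    (hb : k.IsBounded) (P Q : Measure Z) [IsFiniteMeasure P] [IsFiniteMeasure Q] :
    k.sqMMD P Q = k.square.MMD P Q :=
  (PDKernel.MMD_comap (hk.tensor hk) (hb.tensor hb) (measurable_diag Z) P Q).symm

theorem measurable_baseXY {𝓦 𝓧 𝓨 : Type*} [MeasurableSpace 𝓦] [MeasurableSpace 𝓧]
    [MeasurableSpace 𝓨] {n m : ℕ} (c : ℝ) (Q : Fin n → Kernel (Fin n → 𝓦 × 𝓨) (𝓧 × 𝓨))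
    (i : Fin n) : Measurable fun d : DataSpace 𝓦 𝓧 𝓨 n m => baseXY c Q d i :=
  measurable_dpBase c ((Q i).measurable.comp measurable_fst) fun j => by fun_prop

theorem measurable_baseX {𝓦 𝓧 𝓨 : Type*} [MeasurableSpace 𝓦] [MeasurableSpace 𝓧]
    [MeasurableSpace 𝓨] {n m : ℕ} (c : ℝ) (Q : Fin n → Kernel (Fin n → 𝓦 × 𝓨) 𝓧)
    (i : Fin n) : Measurable fun d : DataSpace 𝓦 𝓧 𝓨 n m => baseX c Q d i :=
  measurable_dpBase c ((Q i).measurable.comp measurable_fst) fun j => by fun_prop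

/-- The conditional law enters the right side only through the bound `a`, which makes the estimate
uniform in the parameter. -/
theorem abs_mmdLoss_sub_le {X Y : Type*} [MeasurableSpace X] [MeasurableSpace Y]
    {kX : PDKernel X} {kY : PDKernel Y} (hX : kX.IsMeasurable) (hY : kY.IsMeasurable)
    (hXb : kX.IsBounded) (hYb : kY.IsBounded) (κ : Kernel X Y) [IsMarkovKernel κ]
    (C : kX.H →L[ℝ] kY.H) (hC : ∀ x, C (kX.feature x) = kY.meanEmbedding (κ x)) {a : ℝ}
    (ha : ‖C‖ ≤ a) (P P' : Measure (X × Y)) (Q Q' : Measure X) [IsFiniteMeasure Q]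
    [IsFiniteMeasure Q'] :
    |mmdLoss kX kY P Q κ - mmdLoss kX kY P' Q' κ|
      ≤ (kX.tensor kY).MMD P P' + a * kX.square.MMD Q Q' := by
  have h1 := MMD_compProd_le hX hY hXb hYb κ C hC ha Q Q'
  rw [PDKernel.sqMMD_eq hX hXb] at h1
  refine le_trans ?_ (add_le_add_right h1 _)
  unfold mmdLoss PDKernel.MMD
  refine (abs_norm_sub_norm_le _ _).trans ?_
  rw [sub_sub_sub_comm]
  exact norm_sub_le _ _

end MMDNPL

theorem mainTheorem2
    {Ω 𝓦 𝓧 𝓨 𝓡 : Type*} [MeasurableSpace Ω] [MeasurableSpace 𝓦] [MeasurableSpace 𝓧]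
    [MeasurableSpace 𝓨] [MeasurableSpace 𝓡]
    (Pr : Measure Ω) [IsProbabilityMeasure Pr]
    -- the parameter set, the regression function, and the response law `P_r` with regression
    -- value `r`, so that `P_{g(x, θ)}` is the law of `Y` given `X = x` under the parameter `θ`
    {p : ℕ} (Θ : Set (EuclideanSpace ℝ (Fin p)))
    (g : 𝓧 → EuclideanSpace ℝ (Fin p) → 𝓡) (hg : ∀ θ, Measurable fun x => g x θ)
    (PY : Kernel 𝓡 𝓨) [IsMarkovKernel PY]
    -- the kernels
    (kX : PDKernel 𝓧) (kY : PDKernel 𝓨)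
    (hkX_meas : kX.IsMeasurable) (hkY_meas : kY.IsMeasurable)
    (hkX_bdd : kX.IsBounded) (hkY_bdd : kY.IsBounded)
    (hkX_char : kX.IsCharacteristic) (hkY_char : kY.IsCharacteristic)
    -- the conditional mean embeddings extend to uniformly bounded operators between the RKHSs
    (hC : ∃ Λ : ℝ, ∀ θ ∈ Θ, ∃ C : kX.H →L[ℝ] kY.H,
      (∀ x, C (kX.feature x) = kY.meanEmbedding (PY (g x θ))) ∧ ‖C‖ ≤ Λ)
    -- observations, pseudo-samples, DP parameters and prior centring measures
    (W : ℕ → Ω → 𝓦) (Y : ℕ → Ω → 𝓨)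
    (c : ℕ → ℝ) (m : ℕ → ℕ) (hc : ∀ n, 0 ≤ c n) (hm : ∀ n, 1 ≤ m n)
    (Xtilde : ∀ n, Fin n → Fin (m n) → Ω → 𝓧)
    (QXY : ∀ n, Fin n → Kernel (Fin n → 𝓦 × 𝓨) (𝓧 × 𝓨)) [∀ n i, IsMarkovKernel (QXY n i)]
    (QX : ∀ n, Fin n → Kernel (Fin n → 𝓦 × 𝓨) 𝓧) [∀ n i, IsMarkovKernel (QX n i)]
    -- the DP posterior realisations
    (PDPXY : ∀ n, Fin n → Ω → Measure (𝓧 × 𝓨)) (PDPX : ∀ n, Fin n → Ω → Measure 𝓧)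
    (hDPXY : ∀ n, IsConditionallyIndepDP Pr (dataSample W Y (Xtilde n)) (c n + m n)
      (baseXY (c n) (QXY n)) (PDPXY n))
    (hDPX : ∀ n, IsConditionallyIndepDP Pr (dataSample W Y (Xtilde n)) (c n + m n)
      (baseX (c n) (QX n)) (PDPX n))
    -- the estimator is a minimiser over `Θ` of the DP-based MMD loss
    (θhat : ℕ → Ω → EuclideanSpace ℝ (Fin p))
    (hθhat : ∀ n, ∀ᵐ ω ∂Pr, θhat n ω ∈ Θ ∧
      IsMinOn (fun θ => mmdLoss kX kY (avgMeasure fun i => PDPXY n i ω)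
        (avgMeasure fun i => PDPX n i ω) (PY.comap (fun x => g x θ) (hg θ))) Θ (θhat n ω))
    -- the averaged base measures converge to fixed limits
    (PXYinf : Measure (𝓧 × 𝓨)) [IsProbabilityMeasure PXYinf]
    (PXinf : Measure 𝓧) [IsProbabilityMeasure PXinf]
    (hXYinf : TendstoInMeasure Pr
      (fun n ω => (kX.tensor kY).MMD
        (avgMeasure (baseXY (c n) (QXY n) (dataSample W Y (Xtilde n) ω))) PXYinf)
      atTop fun _ => 0)
    (hXinf : TendstoInMeasure Pr
      (fun n ω => kX.sqMMD
        (avgMeasure (baseX (c n) (QX n) (dataSample W Y (Xtilde n) ω))) PXinf)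
      atTop fun _ => 0)
    -- the limiting loss
    (M : EuclideanSpace ℝ (Fin p) → ℝ)
    (hM : ∀ θ, M θ = mmdLoss kX kY PXYinf PXinf (PY.comap (fun x => g x θ) (hg θ)))
    (hΘ : IsCompact Θ) (hMcont : ContinuousOn M Θ)
    (θdag : EuclideanSpace ℝ (Fin p)) (hθdag : θdag ∈ interior Θ)
    (hmin : ∀ θ ∈ Θ, θ ≠ θdag → M θdag < M θ) :
    TendstoInMeasure Pr θhat atTop fun _ => θdag := by
  have : ∀ n d i, IsProbabilityMeasure
      (baseXY (𝓧 := 𝓧) (m := m n) (c n) (QXY n) d i) := fun n d i =>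
    isProbabilityMeasure_dpBase (hm n) (hc n) _ _
  have : ∀ n d i, IsProbabilityMeasure
      (baseX (𝓧 := 𝓧) (m := m n) (c n) (QX n) d i) := fun n d i =>
    isProbabilityMeasure_dpBase (hm n) (hc n) _ _
  have ha : ∀ n, 0 < c n + m n := fun n => by
    have h1 : (1 : ℝ) ≤ m n := by exact_mod_cast hm n
    linarith [hc n]
  obtain ⟨Λ, hΛ⟩ := hC
  -- Strict positivity is needed to rescale convergence in probability by `a`.
  let a : ℝ := |Λ| + 1
  have ha0 : 0 < a := by positivity
  have hXY := tendstoInMeasure_zero_of_le_add (fun n ω => PDKernel.MMD_nonneg _ _ _)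
    (Eventually.of_forall fun n => ae_of_all _ fun ω => PDKernel.MMD_triangle _ _ _ PXYinf)
    (tendstoInMeasure_MMD_avgMeasure ha (fun n i => measurable_baseXY (c n) (QXY n) i)
      (fun n d i => inferInstance) hDPXY (hkX_meas.tensor hkY_meas) (hkX_bdd.tensor hkY_bdd))
    hXYinf
  have hX := tendstoInMeasure_zero_of_le_add
    (f := fun n ω => kX.square.MMD (avgMeasure fun i => PDPX n i ω) PXinf)
    (fun n ω => PDKernel.MMD_nonneg _ _ _)
    (by
      filter_upwards [eventually_ne_atTop 0] with n hn
      refine ae_of_all _ fun ω => ?_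
      have := isProbabilityMeasure_avgMeasure hn
        (baseX (c n) (QX n) (dataSample W Y (Xtilde n) ω))
      rw [PDKernel.sqMMD_eq hkX_meas hkX_bdd]
      exact PDKernel.MMD_triangle _ _ _ PXinf)
    (tendstoInMeasure_MMD_avgMeasure ha (fun n i => measurable_baseX (c n) (QX n) i)
      (fun n d i => inferInstance) hDPX hkX_meas.square hkX_bdd.square)
    hXinf
  have hR := tendstoInMeasure_zero_of_le_add
    (fun n ω => add_nonneg (PDKernel.MMD_nonneg _ _ _)
      (mul_nonneg ha0.le (PDKernel.MMD_nonneg _ _ _)))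
    (Eventually.of_forall fun n => ae_of_all _ fun ω => le_rfl) hXY
    (tendstoInMeasure_const_mul_zero ha0 hX)
  refine tendstoInMeasure_argmin hΘ hMcont (interior_subset hθdag) hmin hθhat ?_ hR
  filter_upwards [eventually_ne_atTop 0] with n hn
  filter_upwards [(hDPX n).ae_isProbabilityMeasure (ha n) fun d i => inferInstance] with ω hω θ hθ
  have := isProbabilityMeasure_avgMeasure hn fun i => PDPX n i ω
  obtain ⟨C, hCθ, hCn⟩ := hΛ θ hθ
  rw [hM]
  exact abs_mmdLoss_sub_le hkX_meas hkY_meas hkX_bdd hkY_bdd _ C hCθ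
    (hCn.trans ((le_abs_self Λ).trans (lt_add_one _).le)) _ _ _ _
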